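/- Let $n\ge 1$ and let $F$ be a germ of holomorphic diffeomorphism of $\mathbb C^n$ fixing $0$, whose differential $dF_0$ is diagonalizable with eigenvalues $\lambda_1,\dots,\lambda_n$. For $z\in\mathbb C^n$ and $l\in\mathbb N^n$ write $z^l=z_1^{l_1}\cdots z_n^{l_n}$ and $|l|=l_1+\dots+l_n$. Assume that for some $1\le m\le n$ the germ $F$ is *one-resonant with respect to* $\{\lambda_1,\dots,\lambda_m\}$: there is a multi-index $\alpha=(\alpha_1,\dots,\alpha_m,0,\dots,0)\neq 0$ in $\mathbb N^n$ such that, for $1\le j\le m$ and $l\in\mathbb N^n$, one has $|l|\ge 2$ and $\lambda_j=\lambda^l$ if and only if $l=s\alpha+e_j$ for some integer $s\ge 1$. Assume that in suitable local holomorphic coordinates at $0$ the differential of $F$ is $\mathrm{diag}(\lambda_1,\dots,\lambda_n)$ and $$F_j(z)=\lambda_jz_j+a_jz^{k\alpha}z_j+O(|z|^{k|\alpha|+2}),\qquad j=1,\dots,m,$$ with $k\ge 1$ and $(a_1,\dots,a_m)\ne 0$ (so that $k$ is the *order* of $F$ with respect to $\{\lambda_1,\dots,\lambda_m\}$). Put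 $\Lambda=\sum_{j=1}^m a_j\alpha_j/\lambda_j$. Assume that $F$ is *non-degenerate*, that is $\Lambda\neq0$, and *parabolically attracting*, that is $$|\lambda_j|=1\quad\text{and}\quad \operatorname{Re}\bigl(a_j\lambda_j^{-1}\Lambda^{-1}\bigr)>0,\qquad j=1,\dots,m,$$ and that $|\lambda_j|<1$ for $j>m$. A *basin of attraction* for $F$ at $0$ is a nonempty open set $U\subset\mathbb C^n$ with $0\in\overline U$ for which there is a neighborhood basis $\{\Omega_i\}$ of $0$ such that, for every $i$, $F(U\cap\Omega_i)\subset U\cap\Omega_i$ and $F^{\circ q}(z)\to0$ as $q\to\infty$ for all $z\in U\cap\Omega_i$. Then there are $k$ pairwise disjoint basins of attraction $B_1,\dots,B_k$ for $F$ at $0$, each with $0\in\partial B_j$. They can be chosen to be built over sectors in the $k$ petals of the germ induced by $F$ on $u=z^\alpha$, in the following sense. There are local holomorphic coordinates $z$ at $0$ in which $F$ becomes a germ $G$ of the form above, with the same $k$ and $a_1,\dots,a_m$; a germ $h(u)=u+\Lambda u^{k+1}+O(|u|^{k+2})$ of holomorphic map at $0\in\mathbb C$; and numbers $\beta,\delta,\varepsilon>0$,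 $N\in\mathbb N$ with $\beta|\alpha|<1$ and $\beta N>k+1$, such that $G(z)^\alpha=h(z^\alpha)+O(|z|^N)$ and the following holds. Let $v_1,\dots,v_k$ be the $k$-th roots of $-|\Lambda|/\Lambda$ and let $$S_j=\{u\in\mathbb C:\ |\Lambda u^k+\delta|<\delta,\ |\operatorname{Arg}(u/v_j)|<\varepsilon\}.$$ Then $S_j$ is contained in an attracting petal $P_j$ for $h$ centered at $v_j$, and in the coordinates $z$ $$B_j=\{z:\ u=z^\alpha\in S_j,\ |z_i|<|u|^\beta\ \text{for } i=1,\dots,n\}.$$ Here an attracting petal for $h$ centered at $v$ is a simply connected domain $P$ on which $h$ is holomorphic, with $0\in\partial P$ and $h(P)\subset P$, such that for all $u\in P$ one has $h^{\circ q}(u)\to0$, $h^{\circ q}(u)\ne0$ for all $q$, and $h^{\circ q}(u)/|h^{\circ q}(u)|\to v$. -/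

import Mathlib

open Filter Topology Asymptotics

namespace OneRes

/-- `F` represents a germ at `0` of holomorphic diffeomorphism of `ℂⁿ` fixing `0`. -/
structure IsGermDiffeo {n : ℕ} (F : (Fin n → ℂ) → (Fin n → ℂ)) : Prop where
  analytic : AnalyticAt ℂ F 0
  map_zero : F 0 = 0
  invertible : (fderiv ℂ F 0).IsInvertible

/-- The monomial `z ^ α = z₁ ^ α₁ ⋯ zₙ ^ αₙ`. -/
def mon {n : ℕ} (α : Fin n → ℕ) (z : Fin n → ℂ) : ℂ := ∏ i, z i ^ α i

/-- The differential of `F` at `0` is diagonalizable, and its eigenvalues, repeated according to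
multiplicity, are `lam 0, …, lam (n - 1)`. -/
def HasEigenvalues {n : ℕ} (F : (Fin n → ℂ) → (Fin n → ℂ)) (lam : Fin n → ℂ) : Prop :=
  ∃ b : Module.Basis (Fin n) ℂ (Fin n → ℂ), ∀ i, fderiv ℂ F 0 (b i) = lam i • b i

/-- `(j, l)` is a resonance of `lam`: the multi-index `l` has `|l| ≥ 2` and `λ_j = λ ^ l`. -/
def IsResonance {n : ℕ} (lam : Fin n → ℂ) (j : Fin n) (l : Fin n → ℕ) : Prop :=
  2 ≤ ∑ i, l i ∧ lam j = mon l lam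

/-- `F` is one-resonant with respect to the first `m` of the eigenvalues `lam` of its
differential, with index of resonance `α`: the resonances `(j, l)` with `j` among the first `m`
indices are precisely those with `l = s α + e_j`, `s ≥ 1`. -/
structure IsOneResonant {n : ℕ} (F : (Fin n → ℂ) → (Fin n → ℂ)) (lam : Fin n → ℂ)
    (m : ℕ) (α : Fin n → ℕ) : Prop where
  eigenvalues : HasEigenvalues F lam
  one_le : 1 ≤ m
  le_dim : m ≤ n
  index_ne_zero : α ≠ 0
  index_supp : ∀ j : Fin n, m ≤ (j : ℕ) → α j = 0
  resonance_iff : ∀ j : Fin n, (j : ℕ) < m → ∀ l : Fin n → ℕ,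
    IsResonance lam j l ↔ ∃ s : ℕ, 1 ≤ s ∧ l = s • α + Pi.single j 1

/-- `φ` is a germ of holomorphic change of coordinates which conjugates `F` to `G`, that is
`G = φ⁻¹ ∘ F ∘ φ` as germs at `0`. -/
structure Conjugates {n : ℕ} (φ F G : (Fin n → ℂ) → (Fin n → ℂ)) : Prop where
  diffeo : IsGermDiffeo φ
  conj : ∀ᶠ z in 𝓝 (0 : Fin n → ℂ), F (φ z) = φ (G z)

/-- `G` has diagonal differential `diag lam`, and its first `m` components are
`G_j(z) = λ_j z_j + a_j z^{kα} z_j + O(|z|^{k|α|+2})`, with `k ≥ 1` and `(a_1, …, a_m) ≠ 0`.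
(The entries of `a` after the `m`-th play no role.) -/
structure IsLeadingForm {n : ℕ} (G : (Fin n → ℂ) → (Fin n → ℂ)) (lam : Fin n → ℂ)
    (m : ℕ) (α : Fin n → ℕ) (k : ℕ) (a : Fin n → ℂ) : Prop where
  diffeo : IsGermDiffeo G
  diagonal : ∀ (z : Fin n → ℂ) (i : Fin n), fderiv ℂ G 0 z i = lam i * z i
  one_le : 1 ≤ k
  coeff_ne_zero : ∃ j : Fin n, (j : ℕ) < m ∧ a j ≠ 0
  expansion : ∀ j : Fin n, (j : ℕ) < m →
    (fun z : Fin n → ℂ => G z j - (lam j * z j + a j * mon α z ^ k * z j))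
      =O[𝓝 0] fun z => ‖z‖ ^ ((∑ i, α i) * k + 2)

/-- `k` is the order of `F` with respect to the first `m` eigenvalues, and `a` is the vector of
leading coefficients of `F` in suitable holomorphic coordinates. -/
def HasOrder {n : ℕ} (F : (Fin n → ℂ) → (Fin n → ℂ)) (lam : Fin n → ℂ)
    (m : ℕ) (α : Fin n → ℕ) (k : ℕ) (a : Fin n → ℂ) : Prop :=
  ∃ φ G : (Fin n → ℂ) → (Fin n → ℂ), Conjugates φ F G ∧ IsLeadingForm G lam m α k a

/-- The number `Λ = ∑_{j ≤ m} a_j α_j / λ_j`. -/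
noncomputable def bigLam {n : ℕ} (lam : Fin n → ℂ) (m : ℕ) (α : Fin n → ℕ)
    (a : Fin n → ℂ) : ℂ :=
  ∑ j : Fin n, if (j : ℕ) < m then a j * (α j : ℂ) / lam j else 0

/-- The condition of parabolic attraction, in terms of the leading coefficients `a`. -/
def IsParabolicallyAttracting {n : ℕ} (lam : Fin n → ℂ) (m : ℕ) (α : Fin n → ℕ)
    (a : Fin n → ℂ) : Prop :=
  ∀ j : Fin n, (j : ℕ) < m →
    ‖lam j‖ = 1 ∧ 0 < (a j * (lam j)⁻¹ * (bigLam lam m α a)⁻¹).re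

/-- `U` is a basin of attraction for `F` at `0`. -/
structure IsBasin {n : ℕ} (F : (Fin n → ℂ) → (Fin n → ℂ)) (U : Set (Fin n → ℂ)) : Prop where
  isOpen : IsOpen U
  nonempty : U.Nonempty
  zero_mem_closure : (0 : Fin n → ℂ) ∈ closure U
  exists_basis : ∃ 𝒪 : Set (Set (Fin n → ℂ)),
    (𝓝 (0 : Fin n → ℂ)).HasBasis (fun Ω => Ω ∈ 𝒪) id ∧
    ∀ Ω ∈ 𝒪, Set.MapsTo F (U ∩ Ω) (U ∩ Ω) ∧
      ∀ z ∈ U ∩ Ω, Tendsto (fun q : ℕ => F^[q] z) atTop (𝓝 0)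

/-- `P` is an attracting petal, centered at the direction `v`, for the germ `h` at `0` of
holomorphic self-map of `ℂ`. -/
structure IsAttractingPetal (h : ℂ → ℂ) (v : ℂ) (P : Set ℂ) : Prop where
  isOpen : IsOpen P
  simplyConnected : SimplyConnectedSpace P
  zero_mem_frontier : (0 : ℂ) ∈ frontier P
  analytic : AnalyticOnNhd ℂ h P
  mapsTo : Set.MapsTo h P P
  tendsto_zero : ∀ u ∈ P, Tendsto (fun q : ℕ => h^[q] u) atTop (𝓝 0)
  iterate_ne_zero : ∀ u ∈ P, ∀ q : ℕ, h^[q] u ≠ 0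
  tendsto_direction : ∀ u ∈ P,
    Tendsto (fun q : ℕ => h^[q] u / (‖h^[q] u‖ : ℂ)) atTop (𝓝 v)

/-- The sector `{u : |A u^k + δ| < δ, |Arg (u / v)| < ε}` around the direction `v`. -/
def petalSector (A : ℂ) (k : ℕ) (δ ε : ℝ) (v : ℂ) : Set ℂ :=
  {u | ‖A * u ^ k + (δ : ℂ)‖ < δ ∧ |(u / v).arg| < ε}

/-- The set `{z : u = z^α ∈ S, |z_i| < |u|^β for all i}` over `S ⊆ ℂ`. -/
def basinOver {n : ℕ} (α : Fin n → ℕ) (β : ℝ) (S : Set ℂ) : Set (Fin n → ℂ) :=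
  {z | mon α z ∈ S ∧ ∀ i, ‖z i‖ < ‖mon α z‖ ^ β}

/-- The sets `B j` are built over sectors in the `k` petals of the germ
`h(u) = u + Λ u^{k+1} + O(|u|^{k+2})` which `F` induces on `u = z^α`.
Here `φ` is a holomorphic chart on the open set `W ∋ 0` in which `F` becomes `G`, and `h` is
induced by `G` in the sense that `G(z)^α = h(z^α) + O(|z|^N)`, where `N β > k + 1`, so that
the error term is `o(|u|^{k+1})` on the sets `basinOver α β S`. -/
def BuiltOverPetals {n : ℕ} (F : (Fin n → ℂ) → (Fin n → ℂ)) (lam : Fin n → ℂ)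
    (m : ℕ) (α : Fin n → ℕ) (k : ℕ) (a : Fin n → ℂ) (B : Fin k → Set (Fin n → ℂ)) : Prop :=
  ∃ (φ G : (Fin n → ℂ) → (Fin n → ℂ)) (W : Set (Fin n → ℂ)) (h : ℂ → ℂ) (N : ℕ)
    (β δ ε : ℝ) (v : Fin k → ℂ) (P : Fin k → Set ℂ),
    Conjugates φ F G ∧ IsLeadingForm G lam m α k a ∧
    IsOpen W ∧ (0 : Fin n → ℂ) ∈ W ∧ AnalyticOnNhd ℂ φ W ∧ Set.InjOn φ W ∧
    AnalyticAt ℂ h 0 ∧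
    (fun u : ℂ => h u - (u + bigLam lam m α a * u ^ (k + 1))) =O[𝓝 0]
      (fun u => ‖u‖ ^ (k + 2)) ∧
    (fun z : Fin n → ℂ => mon α (G z) - h (mon α z)) =O[𝓝 0] (fun z => ‖z‖ ^ N) ∧
    0 < β ∧ β * (∑ i, α i : ℕ) < 1 ∧ (k : ℝ) + 1 < β * N ∧
    0 < δ ∧ 0 < ε ∧
    Function.Injective v ∧
    (∀ j, v j ^ k = -((‖bigLam lam m α a‖ : ℂ) / bigLam lam m α a)) ∧
    (∀ j, IsAttractingPetal h (v j) (P j)) ∧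
    (∀ j, petalSector (bigLam lam m α a) k δ ε (v j) ⊆ P j) ∧
    (∀ j, basinOver α β (petalSector (bigLam lam m α a) k δ ε (v j)) ⊆ W) ∧
    (∀ j, B j = φ '' basinOver α β (petalSector (bigLam lam m α a) k δ ε (v j)))

end OneRes

/-!
Poincaré–Dulac changes of coordinates bring the first `m` components of `F`, up to any order `N`,
to the form `z_j ↦ z_j g_j(u)` with `g_j(u) = λ_j (1 + (a_j / λ_j) u ^ k + ⋯)`, because the
resonant monomials are `z_j u ^ s`, `u = z ^ α`. Hence `u` is moved by the germ
`h(u) = u ∏ⱼ g_j(u) ^ α_j = u + Λ u ^ (k + 1) + ⋯` up to `O(‖z‖ ^ N)`, an error which is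
`o(|u| ^ (k + 1))` as long as `|z_i| < |u| ^ β` for all `i`. In the Fatou coordinate
`w = -1 / (Λ u ^ k)` both `h` and the true motion of `u` are the translation `w ↦ w + k` up to
`o(1)`, so they preserve the sectors corresponding to truncated cones around the positive axis.
There `|u| ^ β` gets multiplied by about `1 + β Re (Λ u ^ k)`, while `|z_j|` is at most multiplied
by about `1 + Re (b_j Λ u ^ k)`, `b_j = a_j / (λ_j Λ)`, for `j ≤ m` and by a constant less than `1`
for `j > m`. Since `Re (Λ u ^ k) < 0` and `β < Re b_j`, on a narrow enough cone the inequalities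
`|z_i| < |u| ^ β` persist.
-/

namespace OneRes

section Monomials

variable {n : ℕ}

lemma prod_comp_eq_mon {d : ℕ} (r : Fin d → Fin n) (z : Fin n → ℂ) :
    ∏ t, z (r t) = mon (fun i => (Finset.univ.filter fun t => r t = i).card) z := by
  rw [mon, ← Finset.prod_fiberwise Finset.univ r]
  refine Finset.prod_congr rfl fun i _ => ?_
  rw [Finset.prod_congr rfl (g := fun _ => z i), Finset.prod_const]
  intro t ht
  rw [(Finset.mem_filter.mp ht).2]

lemma mon_smul_add_single (α : Fin n → ℕ) (s : ℕ) (j : Fin n) (z : Fin n → ℂ) :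
    mon (s • α + Pi.single j 1) z = mon α z ^ s * z j := by
  simp only [mon, Pi.add_apply, Pi.smul_apply, smul_eq_mul, pow_add, Finset.prod_mul_distrib,
    ← Finset.prod_pow]
  congr 1
  · exact Finset.prod_congr rfl fun i _ => by rw [← pow_mul, mul_comm]
  · rw [Finset.prod_eq_single j] <;> simp +contextual

lemma analyticAt_apply (i : Fin n) (z₀ : Fin n → ℂ) :
    AnalyticAt ℂ (fun z : Fin n → ℂ => z i) z₀ :=
  (ContinuousLinearMap.proj (R := ℂ) (φ := fun _ : Fin n => ℂ) i).analyticAt z₀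

lemma analyticAt_mon (α : Fin n → ℕ) (z₀ : Fin n → ℂ) : AnalyticAt ℂ (mon α) z₀ :=
  Finset.analyticAt_fun_prod _ fun i _ => (analyticAt_apply i z₀).pow _

lemma continuous_mon (α : Fin n → ℕ) : Continuous (mon α) := by
  unfold mon
  fun_prop

lemma norm_mon_le (α : Fin n → ℕ) (z : Fin n → ℂ) : ‖mon α z‖ ≤ ‖z‖ ^ ∑ i, α i := by
  rw [mon, norm_prod, ← Finset.prod_pow_eq_pow_sum]
  refine Finset.prod_le_prod (fun i _ => norm_nonneg _) fun i _ => ?_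
  rw [norm_pow]
  exact pow_le_pow_left₀ (norm_nonneg _) (norm_le_pi_norm z i) _

lemma sum_pos_of_ne_zero {α : Fin n → ℕ} (hα : α ≠ 0) : 0 < ∑ i, α i := by
  obtain ⟨i, hi⟩ := Function.ne_iff.mp hα
  exact Finset.sum_pos' (fun _ _ => Nat.zero_le _) ⟨i, Finset.mem_univ _, Nat.pos_of_ne_zero hi⟩

lemma mon_zero {α : Fin n → ℕ} (hα : α ≠ 0) : mon α 0 = 0 := by
  have h := norm_mon_le α 0
  rw [norm_zero, zero_pow (sum_pos_of_ne_zero hα).ne'] at h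
  exact norm_le_zero_iff.mp h

lemma isBigO_mon (α : Fin n → ℕ) : mon α =O[𝓝 0] fun z => ‖z‖ ^ ∑ i, α i :=
  IsBigO.of_norm_le fun z => norm_mon_le α z

lemma isBigO_apply (i : Fin n) : (fun z : Fin n → ℂ => z i) =O[𝓝 0] fun z => ‖z‖ :=
  IsBigO.of_norm_le fun z => norm_le_pi_norm z i

end Monomials

section TaylorExpansion

variable {𝕜 E E' : Type*} [NontriviallyNormedField 𝕜] [NormedAddCommGroup E] [NormedSpace 𝕜 E]
  [NormedAddCommGroup E'] [NormedSpace 𝕜 E']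

lemma isBigO_norm_pow {E : Type*} [SeminormedAddCommGroup E] {d e : ℕ} (h : e ≤ d) :
    (fun z : E => ‖z‖ ^ d) =O[𝓝 0] fun z => ‖z‖ ^ e := by
  refine IsBigO.of_bound 1 ?_
  filter_upwards [Metric.ball_mem_nhds (0 : E) one_pos] with z hz
  rw [mem_ball_zero_iff] at hz
  simpa only [norm_pow, norm_norm, one_mul] using
    pow_le_pow_of_le_one (norm_nonneg _) hz.le h

lemma isBigO_sub_fderiv {f : E → E'} (hf : AnalyticAt 𝕜 f 0) (h0 : f 0 = 0) :
    (fun z => f z - fderiv 𝕜 f 0 z) =O[𝓝 0] fun z => ‖z‖ ^ 2 := by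
  obtain ⟨p, hp⟩ := hf
  refine (hp.isBigO_sub_partialSum_pow 2).congr_left fun z => ?_
  rw [zero_add, FormalMultilinearSeries.partialSum, Finset.sum_range_succ, Finset.sum_range_one,
    hp.coeff_zero, h0, zero_add, hp.fderiv_eq]
  congr 1

lemma partialSum_eq_zero_of_isBigO {f : E → E'} {p : FormalMultilinearSeries 𝕜 E E'}
    (hp : HasFPowerSeriesAt f p 0) {d : ℕ} (hf : f =O[𝓝 0] fun z => ‖z‖ ^ d) (z : E) :
    p.partialSum d z = 0 := by
  induction d generalizing z with
  | zero => simp [FormalMultilinearSeries.partialSum]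
  | succ d ih =>
    have hsum (z : E) : p.partialSum (d + 1) z = p d fun _ => z := by
      have h := ih (hf.trans (isBigO_norm_pow d.le_succ)) z
      rw [FormalMultilinearSeries.partialSum] at h ⊢
      rw [Finset.sum_range_succ, h, zero_add]
    have hO : (fun z => p d fun _ => z) =O[𝓝 0] fun z => ‖z‖ ^ (d + 1) := by
      refine (hf.sub (hp.isBigO_sub_partialSum_pow (d + 1))).congr_left fun z => ?_
      rw [zero_add, hsum, sub_sub_cancel]
    rw [hsum]
    exact hO.continuousMultilinearMap_apply_eq_zero z

end TaylorExpansion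

section HomogeneousForms

variable {n d : ℕ}

/-- The homogeneous polynomial of degree `d` with coefficients `c`, written as a sum over all
`r : Fin d → Fin n`, that is, with the coefficients of a (not necessarily symmetric) `d`-linear
form, so that no multi-indices are needed. -/
noncomputable def homForm (c : (Fin d → Fin n) → ℂ) (z : Fin n → ℂ) : ℂ :=
  ∑ r, c r * ∏ t, z (r t)

lemma analyticAt_homForm (c : (Fin d → Fin n) → ℂ) (z₀ : Fin n → ℂ) :
    AnalyticAt ℂ (homForm c) z₀ :=
  Finset.analyticAt_fun_sum _ fun _ _ => analyticAt_const.mul <|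
    Finset.analyticAt_fun_prod _ fun _ _ => analyticAt_apply _ _

lemma isBigO_homForm (c : (Fin d → Fin n) → ℂ) : homForm c =O[𝓝 0] fun z => ‖z‖ ^ d := by
  have hterm (r : Fin d → Fin n) :
      (fun z : Fin n → ℂ => c r * ∏ t, z (r t)) =O[𝓝 0] fun z => ‖z‖ ^ d := by
    simpa using (IsBigO.finsetProd (s := Finset.univ)
      fun t _ => isBigO_apply (r t)).const_mul_left (c r)
  exact IsBigO.fun_sum fun r _ => hterm r

lemma exists_homogeneous_part {f : (Fin n → ℂ) → ℂ} (hf : AnalyticAt ℂ f 0)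
    (hd : f =O[𝓝 0] fun z => ‖z‖ ^ d) :
    ∃ c : (Fin d → Fin n) → ℂ,
      (fun z => f z - homForm c z) =O[𝓝 0] fun z => ‖z‖ ^ (d + 1) := by
  obtain ⟨p, hp⟩ := hf
  refine ⟨fun r => p d fun t => Pi.single (r t) 1, ?_⟩
  refine (hp.isBigO_sub_partialSum_pow (d + 1)).congr_left fun z => ?_
  have h0 := partialSum_eq_zero_of_isBigO hp hd z
  rw [FormalMultilinearSeries.partialSum] at h0 ⊢
  rw [Finset.sum_range_succ, h0, zero_add, zero_add]
  congr 1
  have hz : (fun _ : Fin d => z) = fun _ : Fin d => ∑ i, z i • (Pi.single i 1 : Fin n → ℂ) := by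
    funext _
    ext i
    simp [Finset.sum_apply, Pi.single_apply]
  rw [hz, ContinuousMultilinearMap.map_sum]
  refine Finset.sum_congr rfl fun r _ => ?_
  rw [ContinuousMultilinearMap.map_smul_univ, smul_eq_mul, mul_comm]

lemma isBigO_prod_sub_prod {ι X : Type*} {l : Filter X} {g : X → ℝ} (s : Finset ι)
    {A B : ι → X → ℂ} {e : ℕ} (hA : ∀ i, A i =O[l] g) (hB : ∀ i, B i =O[l] g)
    (hAB : ∀ i, (fun z => A i z - B i z) =O[l] fun z => g z ^ (e + 1)) :
    (fun z => ∏ i ∈ s, A i z - ∏ i ∈ s, B i z) =O[l] fun z => g z ^ (s.card + e) := by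
  classical
  have hprod (s : Finset ι) : (fun z => ∏ i ∈ s, A i z) =O[l] fun z => g z ^ s.card := by
    simpa using IsBigO.finsetProd (s := s) fun i _ => hA i
  induction s using Finset.induction_on with
  | empty => simpa using isBigO_zero _ _
  | insert i s hi ih =>
    have h1 := (hAB i).mul (hprod s)
    have h2 := (hB i).mul ih
    rw [Finset.card_insert_of_notMem hi]
    refine ((h1.congr_right fun z => ?_).add (h2.congr_right fun z => ?_)).congr_left fun z => ?_
    · ring
    · ring
    · rw [Finset.prod_insert hi, Finset.prod_insert hi]; ring

lemma isBigO_homForm_sub {X : Type*} {l : Filter X} {g : X → ℝ} (c : (Fin d → Fin n) → ℂ)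
    {x y : X → Fin n → ℂ} {e : ℕ} (hx : x =O[l] g) (hy : y =O[l] g)
    (hxy : (fun z => x z - y z) =O[l] fun z => g z ^ (e + 1)) :
    (fun z => homForm c (x z) - homForm c (y z)) =O[l] fun z => g z ^ (d + e) := by
  have hprod (r : Fin d → Fin n) :
      (fun z => c r * (∏ t, x z (r t) - ∏ t, y z (r t))) =O[l] fun z => g z ^ (d + e) := by
    simpa using (isBigO_prod_sub_prod Finset.univ (fun t => isBigO_pi.mp hx (r t))
      (fun t => isBigO_pi.mp hy (r t)) fun t => isBigO_pi.mp hxy (r t)).const_mul_left (c r)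
  refine (IsBigO.fun_sum (s := Finset.univ) fun r _ => hprod r).congr_left fun z => ?_
  simp only [homForm, mul_sub, Finset.sum_sub_distrib]

lemma isBigO_id_add {P : (Fin n → ℂ) → Fin n → ℂ} (hP : P =O[𝓝 0] fun z => ‖z‖ ^ 2) :
    (fun z => z + P z) =O[𝓝 0] fun z => ‖z‖ := by
  have h : P =O[𝓝 0] fun z => ‖z‖ := by
    simpa only [pow_one] using hP.trans (isBigO_norm_pow one_le_two)
  exact (isBigO_refl (fun z : Fin n → ℂ => z) _).norm_right.add h

lemma isBigO_comp_id_add_sub {f : (Fin n → ℂ) → ℂ} {P : (Fin n → ℂ) → Fin n → ℂ}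
    (hf : AnalyticAt ℂ f 0) (hd : f =O[𝓝 0] fun z => ‖z‖ ^ d)
    (hP : P =O[𝓝 0] fun z => ‖z‖ ^ 2) :
    (fun z => f (z + P z) - f z) =O[𝓝 0] fun z => ‖z‖ ^ (d + 1) := by
  obtain ⟨c, hc⟩ := exists_homogeneous_part hf hd
  have hid := isBigO_id_add hP
  have htends : Tendsto (fun z => z + P z) (𝓝 0) (𝓝 0) := hid.trans_tendsto tendsto_norm_zero
  have hform : (fun z => homForm c (z + P z) - homForm c z) =O[𝓝 0] fun z => ‖z‖ ^ (d + 1) :=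
    isBigO_homForm_sub c hid (isBigO_refl (fun z : Fin n → ℂ => z) _).norm_right
      (by simpa only [add_sub_cancel_left] using hP)
  have hrem := (hc.comp_tendsto htends).trans (hid.norm_left.pow (d + 1))
  refine ((hrem.add hform).sub hc).congr_left fun z => ?_
  simp only [Function.comp_apply]
  ring

end HomogeneousForms

section Germs

variable {n : ℕ} {φ ψ F G H : (Fin n → ℂ) → Fin n → ℂ}

lemma IsGermDiffeo.tendsto (hφ : IsGermDiffeo φ) : Tendsto φ (𝓝 0) (𝓝 0) := by
  simpa only [ContinuousAt, hφ.map_zero] using hφ.analytic.continuousAt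

lemma IsGermDiffeo.comp (hφ : IsGermDiffeo φ) (hψ : IsGermDiffeo ψ) : IsGermDiffeo (φ ∘ ψ) := by
  have hφψ : AnalyticAt ℂ φ (ψ 0) := by rw [hψ.map_zero]; exact hφ.analytic
  refine ⟨hφψ.comp hψ.analytic, by simp [hφ.map_zero, hψ.map_zero], ?_⟩
  rw [fderiv_comp _ hφψ.differentiableAt hψ.analytic.differentiableAt, hψ.map_zero]
  exact hφ.invertible.comp hψ.invertible

lemma IsGermDiffeo.exists_rightInverse (hφ : IsGermDiffeo φ) :
    ∃ ψ : (Fin n → ℂ) → Fin n → ℂ, IsGermDiffeo ψ ∧ ∀ᶠ z in 𝓝 0, φ (ψ z) = z := by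
  obtain ⟨L, hL⟩ := hφ.invertible
  have hφ' : HasStrictFDerivAt φ (L : (Fin n → ℂ) →L[ℂ] Fin n → ℂ) 0 := by
    rw [hL]; exact hφ.analytic.hasStrictFDerivAt
  have hinv := hφ'.to_localInverse
  have han : AnalyticAt ℂ hφ'.localInverse (φ 0) :=
    (hφ'.toOpenPartialHomeomorph φ).analyticAt_symm' (i := L)
      hφ'.mem_toOpenPartialHomeomorph_source hφ.analytic hL.symm
  have hright := hφ'.eventually_right_inverse
  have hzero := hφ'.localInverse_apply_image
  rw [hφ.map_zero] at hinv han hright hzero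
  refine ⟨hφ'.localInverse, ⟨han, hzero, ?_⟩, hright⟩
  rw [hinv.hasFDerivAt.fderiv]
  exact ⟨L.symm, rfl⟩

lemma Conjugates.trans (h₁ : Conjugates φ F G) (h₂ : Conjugates ψ G H) :
    Conjugates (φ ∘ ψ) F H := by
  refine ⟨h₁.diffeo.comp h₂.diffeo, ?_⟩
  filter_upwards [h₂.diffeo.tendsto.eventually h₁.conj, h₂.conj] with z hz₁ hz₂
  rw [Function.comp_apply, Function.comp_apply, hz₁, hz₂]

lemma IsGermDiffeo.exists_conjugates (hφ : IsGermDiffeo φ) (hF : IsGermDiffeo F) :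
    ∃ G, Conjugates φ F G ∧ IsGermDiffeo G := by
  obtain ⟨ψ, hψ, hφψ⟩ := hφ.exists_rightInverse
  have hFφ := hF.comp hφ
  refine ⟨ψ ∘ F ∘ φ, ⟨hφ, ?_⟩, hψ.comp hFφ⟩
  filter_upwards [hFφ.tendsto.eventually hφψ] with z hz
  exact hz.symm

lemma Conjugates.fderiv_comp (h : Conjugates φ F G) (hF : IsGermDiffeo F)
    (hG : IsGermDiffeo G) :
    (fderiv ℂ F 0).comp (fderiv ℂ φ 0) = (fderiv ℂ φ 0).comp (fderiv ℂ G 0) := by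
  have hderiv {f g : (Fin n → ℂ) → Fin n → ℂ} (hf : IsGermDiffeo f) (hg : IsGermDiffeo g) :
      fderiv ℂ (f ∘ g) 0 = (fderiv ℂ f 0).comp (fderiv ℂ g 0) := by
    have hfg : DifferentiableAt ℂ f (g 0) := by
      rw [hg.map_zero]; exact hf.analytic.differentiableAt
    rw [_root_.fderiv_comp _ hfg hg.analytic.differentiableAt, hg.map_zero]
  rw [← hderiv hF h.diffeo, ← hderiv h.diffeo hG]
  exact EventuallyEq.fderiv_eq h.conj

lemma hasFDerivAt_id_add {P : (Fin n → ℂ) → Fin n → ℂ} (hP : P =O[𝓝 0] fun z => ‖z‖ ^ 2) :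
    HasFDerivAt (fun z => z + P z) (ContinuousLinearMap.id ℂ (Fin n → ℂ)) 0 := by
  refine .of_isLittleO ?_
  have h := hP.trans_isLittleO (isLittleO_norm_pow_id one_lt_two)
  have hP0 : P 0 = 0 := by simpa using hP.eq_zero_imp.self_of_nhds
  simpa [hP0] using h

lemma isGermDiffeo_id_add {P : (Fin n → ℂ) → Fin n → ℂ} (hP : AnalyticAt ℂ P 0)
    (hPO : P =O[𝓝 0] fun z => ‖z‖ ^ 2) : IsGermDiffeo fun z => z + P z := by
  have hP0 : P 0 = 0 := by simpa using hPO.eq_zero_imp.self_of_nhds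
  refine ⟨analyticAt_id.add hP, by simp [hP0], ?_⟩
  rw [(hasFDerivAt_id_add hPO).fderiv]
  exact ⟨ContinuousLinearEquiv.refl ℂ _, rfl⟩

lemma exists_conjugates_id_add {P : (Fin n → ℂ) → Fin n → ℂ} (hG : IsGermDiffeo G)
    (hP : AnalyticAt ℂ P 0) (hPO : P =O[𝓝 0] fun z => ‖z‖ ^ 2) :
    ∃ H, Conjugates (fun z => z + P z) G H ∧ IsGermDiffeo H ∧ fderiv ℂ H 0 = fderiv ℂ G 0 := by
  obtain ⟨H, hGH, hH⟩ := (isGermDiffeo_id_add hP hPO).exists_conjugates hG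
  have h := hGH.fderiv_comp hG hH
  rw [(hasFDerivAt_id_add hPO).fderiv, ContinuousLinearMap.comp_id,
    ContinuousLinearMap.id_comp] at h
  exact ⟨H, hGH, hH, h.symm⟩

lemma Conjugates.exists_chart (h : Conjugates φ F G) :
    ∃ e : OpenPartialHomeomorph (Fin n → ℂ) (Fin n → ℂ), ⇑e = φ ∧ 0 ∈ e.source ∧
      AnalyticOnNhd ℂ φ e.source ∧ ∀ z ∈ e.source, F (φ z) = φ (G z) := by
  obtain ⟨L, hL⟩ := h.diffeo.invertible
  have hφ' : HasStrictFDerivAt φ (L : (Fin n → ℂ) →L[ℂ] Fin n → ℂ) 0 := by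
    rw [hL]; exact h.diffeo.analytic.hasStrictFDerivAt
  obtain ⟨s, hs, hso, hs0⟩ :=
    eventually_nhds_iff.mp (h.diffeo.analytic.eventually_analyticAt.and h.conj)
  refine ⟨(hφ'.toOpenPartialHomeomorph φ).restrOpen s hso, rfl,
    ⟨hφ'.mem_toOpenPartialHomeomorph_source, hs0⟩, fun z hz => (hs z hz.2).1,
    fun z hz => (hs z hz.2).2⟩

end Germs

section NormalForm

variable {n m k d : ℕ} {lam a : Fin n → ℂ} {α : Fin n → ℕ} {p : Fin n → Polynomial ℂ}
  {G H : (Fin n → ℂ) → Fin n → ℂ}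

/-- The factor `λ_j + a_j u^k + u^{k+1} p_j(u)` by which a germ in normal form multiplies the
coordinate `z_j`, as a function of `u = z^α`. -/
noncomputable def resFactor (lam a : Fin n → ℂ) (k : ℕ) (p : Fin n → Polynomial ℂ) (j : Fin n)
    (u : ℂ) : ℂ :=
  lam j + a j * u ^ k + u ^ (k + 1) * (p j).eval u

lemma analyticAt_resFactor (lam a : Fin n → ℂ) (k : ℕ) (p : Fin n → Polynomial ℂ) (j : Fin n)
    (u₀ : ℂ) : AnalyticAt ℂ (resFactor lam a k p j) u₀ := by
  have hp : AnalyticAt ℂ (fun u => (p j).eval u) u₀ := by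
    simpa using AnalyticAt.aeval_polynomial (analyticAt_id (𝕜 := ℂ) (z := u₀)) (p j)
  unfold resFactor
  fun_prop

lemma analyticAt_resFactor_mon (lam a : Fin n → ℂ) (α : Fin n → ℕ) (k : ℕ)
    (p : Fin n → Polynomial ℂ) (j : Fin n) (z₀ : Fin n → ℂ) :
    AnalyticAt ℂ (fun z => resFactor lam a k p j (mon α z)) z₀ :=
  (analyticAt_resFactor ..).comp (analyticAt_mon α z₀)

lemma resFactor_zero (hk : 1 ≤ k) (j : Fin n) : resFactor lam a k p j 0 = lam j := by
  simp [resFactor, Nat.one_le_iff_ne_zero.mp hk]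

/-- The first `m` components of `G` agree with the resonant normal form
`z_j (λ_j + a_j u^k + u^{k+1} p_j(u))`, `u = z^α`, up to terms of order `d`. -/
def IsNormalUpTo (G : (Fin n → ℂ) → (Fin n → ℂ)) (lam : Fin n → ℂ) (m : ℕ) (α : Fin n → ℕ)
    (k : ℕ) (a : Fin n → ℂ) (p : Fin n → Polynomial ℂ) (d : ℕ) : Prop :=
  ∀ j : Fin n, (j : ℕ) < m →
    (fun z : Fin n → ℂ => G z j - z j * resFactor lam a k p j (mon α z)) =O[𝓝 0]
      fun z => ‖z‖ ^ d

lemma IsLeadingForm.isNormalUpTo (hG : IsLeadingForm G lam m α k a) :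
    IsNormalUpTo G lam m α k a 0 ((∑ i, α i) * k + 2) := by
  intro j hj
  refine (hG.expansion j hj).congr_left fun z => ?_
  simp only [resFactor, Pi.zero_apply, Polynomial.eval_zero]
  ring

lemma isBigO_mul_mon_pow (hα : α ≠ 0) (k : ℕ) (q : Polynomial ℂ) (j : Fin n) :
    (fun z : Fin n → ℂ => z j * (mon α z ^ (k + 1) * q.eval (mon α z))) =O[𝓝 0]
      fun z => ‖z‖ ^ ((∑ i, α i) * k + 2) := by
  have hq : (fun z : Fin n → ℂ => q.eval (mon α z)) =O[𝓝 0] fun _ => (1 : ℝ) :=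
    (q.continuous.comp (continuous_mon α)).continuousAt.isBigO_one ℝ
  have hle : (∑ i, α i) * k + 2 ≤ (∑ i, α i) * (k + 1) + 1 := by
    have := sum_pos_of_ne_zero hα
    rw [mul_add]; omega
  refine (((isBigO_apply j).mul (((isBigO_mon α).pow (k + 1)).mul hq)).congr_right
    fun z => ?_).trans (isBigO_norm_pow hle)
  ring

lemma IsNormalUpTo.expansion (hG : IsNormalUpTo G lam m α k a p d) (hα : α ≠ 0)
    (hd : (∑ i, α i) * k + 2 ≤ d) (j : Fin n) (hj : (j : ℕ) < m) :
    (fun z : Fin n → ℂ => G z j - (lam j * z j + a j * mon α z ^ k * z j)) =O[𝓝 0]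
      fun z => ‖z‖ ^ ((∑ i, α i) * k + 2) := by
  refine (((hG j hj).trans (isBigO_norm_pow hd)).add
    (isBigO_mul_mon_pow hα k (p j) j)).congr_left fun z => ?_
  simp only [resFactor]
  ring

lemma exists_prod_comp_eq_of_resonance {j : Fin n}
    (hres : ∀ l, IsResonance lam j l → ∃ s : ℕ, l = s • α + Pi.single j 1)
    (hd : (∑ i, α i) * k + 2 ≤ d) {r : Fin d → Fin n} (hr : lam j = ∏ t, lam (r t)) :
    ∃ s : ℕ, ∀ z : Fin n → ℂ, ∏ t, z (r t) = z j * (mon α z ^ (k + 1) * mon α z ^ s) := by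
  set l : Fin n → ℕ := fun i => (Finset.univ.filter fun t => r t = i).card with hl
  have hsum : ∑ i, l i = d := by
    rw [← Finset.card_eq_sum_card_fiberwise fun t _ => Finset.mem_univ (r t)]
    simp
  obtain ⟨s, hs⟩ := hres l ⟨by omega, by rw [hr, prod_comp_eq_mon]⟩
  have hsd : s * (∑ i, α i) + 1 = d := by
    rw [← hsum, hs]
    simp [Finset.sum_add_distrib, Finset.mul_sum, Pi.single_apply]
  have hks : k < s := by
    by_contra! hsk
    have := Nat.mul_le_mul_right (∑ i, α i) hsk
    rw [mul_comm] at hd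
    omega
  refine ⟨s - (k + 1), fun z => ?_⟩
  rw [prod_comp_eq_mon, ← hl, hs, mon_smul_add_single, ← pow_add,
    Nat.add_sub_cancel' hks, mul_comm]

lemma exists_homological_solution {j : Fin n}
    (hres : ∀ l, IsResonance lam j l → ∃ s : ℕ, l = s • α + Pi.single j 1)
    (hd : (∑ i, α i) * k + 2 ≤ d) (c : (Fin d → Fin n) → ℂ) :
    ∃ (b : (Fin d → Fin n) → ℂ) (q : Polynomial ℂ), ∀ z : Fin n → ℂ,
      homForm c z + lam j * homForm b z - homForm b (lam * z) =
        z j * (mon α z ^ (k + 1) * q.eval (mon α z)) := by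
  classical
  choose! s hs using fun r : Fin d → Fin n =>
    exists_prod_comp_eq_of_resonance (r := r) hres hd
  refine ⟨fun r => if lam j = ∏ t, lam (r t) then 0 else c r / (∏ t, lam (r t) - lam j),
    ∑ r, if lam j = ∏ t, lam (r t) then Polynomial.C (c r) * Polynomial.X ^ s r else 0,
    fun z => ?_⟩
  rw [homForm, homForm, homForm, Polynomial.eval_finsetSum, Finset.mul_sum, Finset.mul_sum,
    Finset.mul_sum, ← Finset.sum_add_distrib, ← Finset.sum_sub_distrib]
  refine Finset.sum_congr rfl fun r _ => ?_
  simp only [Pi.mul_apply, Finset.prod_mul_distrib]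
  split_ifs with h
  · rw [hs r h z, Polynomial.eval_mul, Polynomial.eval_C, Polynomial.eval_pow,
      Polynomial.eval_X]
    ring
  · have : ∏ t, lam (r t) - lam j ≠ 0 := sub_ne_zero.mpr (Ne.symm h)
    rw [Polynomial.eval_zero]
    field_simp
    ring

lemma exists_homological_solution_of_isBigO {f : (Fin n → ℂ) → ℂ} {j : Fin n}
    (hres : ∀ l, IsResonance lam j l → ∃ s : ℕ, l = s • α + Pi.single j 1)
    (hd : (∑ i, α i) * k + 2 ≤ d) (hf : AnalyticAt ℂ f 0) (hfd : f =O[𝓝 0] fun z => ‖z‖ ^ d) :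
    ∃ (b : (Fin d → Fin n) → ℂ) (q : Polynomial ℂ),
      (fun z => f z + lam j * homForm b z - homForm b (lam * z)
        - z j * (mon α z ^ (k + 1) * q.eval (mon α z))) =O[𝓝 0] fun z => ‖z‖ ^ (d + 1) := by
  obtain ⟨c, hc⟩ := exists_homogeneous_part hf hfd
  obtain ⟨b, q, hbq⟩ := exists_homological_solution hres hd c
  refine ⟨b, q, hc.congr_left fun z => ?_⟩
  rw [← hbq]
  ring

lemma isBigO_mul_comp_id_add_sub {P : (Fin n → ℂ) → Fin n → ℂ} {Q : (Fin n → ℂ) → ℂ}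
    (hQ : AnalyticAt ℂ Q 0) (hP : P =O[𝓝 0] fun z => ‖z‖ ^ d) (hd : 2 ≤ d) (j : Fin n) :
    (fun z => (z + P z) j * Q (z + P z) - (z j * Q z + Q 0 * P z j)) =O[𝓝 0]
      fun z => ‖z‖ ^ (d + 1) := by
  have hid := isBigO_id_add (hP.trans (isBigO_norm_pow hd))
  have htends : Tendsto (fun z => z + P z) (𝓝 0) (𝓝 0) := hid.trans_tendsto tendsto_norm_zero
  have hQP : (fun z => Q (z + P z) - Q z) =O[𝓝 0] fun z => ‖z‖ ^ d := by
    refine (hQ.hasStrictFDerivAt.isBigO_sub.comp_tendsto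
      (htends.prodMk_nhds tendsto_id)).trans (hP.congr_left fun z => ?_)
    simp
  have hQ0 : (fun z => Q (z + P z) - Q 0) =O[𝓝 0] fun z => ‖z‖ := by
    refine (hQ.differentiableAt.isBigO_sub.comp_tendsto htends).trans
      (hid.congr_left fun z => ?_)
    simp
  refine ((((isBigO_apply j).mul hQP).congr_right fun z => ?_).add
    (((isBigO_pi.mp hP j).mul hQ0).congr_right fun z => ?_)).congr_left fun z => ?_
  · ring
  · ring
  · rw [Pi.add_apply]
    ring

lemma isBigO_homForm_comp_sub (hH : IsGermDiffeo H)
    (hdiag : ∀ z i, fderiv ℂ H 0 z i = lam i * z i) (b : (Fin d → Fin n) → ℂ) :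
    (fun z => homForm b (H z) - homForm b (lam * z)) =O[𝓝 0] fun z => ‖z‖ ^ (d + 1) := by
  have hdiag' (z : Fin n → ℂ) : fderiv ℂ H 0 z = lam * z := funext fun i => hdiag z i
  have hsub := isBigO_sub_fderiv hH.analytic hH.map_zero
  simp only [hdiag'] at hsub
  refine isBigO_homForm_sub b ?_ (isBigO_pi.mpr fun i => ?_) hsub
  · simpa [hH.map_zero] using hH.analytic.differentiableAt.isBigO_sub.norm_right
  · exact (isBigO_apply i).const_mul_left (lam i)

lemma exists_conjugates_isNormalUpTo_succ (hα : α ≠ 0)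
    (hres : ∀ j : Fin n, (j : ℕ) < m → ∀ l,
      IsResonance lam j l → ∃ s : ℕ, l = s • α + Pi.single j 1)
    (hG : IsLeadingForm G lam m α k a) (hd : (∑ i, α i) * k + 2 ≤ d)
    (hN : IsNormalUpTo G lam m α k a p d) :
    ∃ φ H p', Conjugates φ G H ∧ IsLeadingForm H lam m α k a ∧
      IsNormalUpTo H lam m α k a p' (d + 1) := by
  set R : Fin n → (Fin n → ℂ) → ℂ := fun j z => G z j - z j * resFactor lam a k p j (mon α z)
    with hR
  have hRa (j : Fin n) : AnalyticAt ℂ (R j) 0 :=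
    ((analyticAt_apply j _).comp hG.diffeo.analytic).sub
      ((analyticAt_apply j 0).mul (analyticAt_resFactor_mon lam a α k p j 0))
  choose! b q hbq using fun (j : Fin n) (hj : (j : ℕ) < m) =>
    exists_homological_solution_of_isBigO (hres j hj) hd (hRa j) (hN j hj)
  set P : (Fin n → ℂ) → Fin n → ℂ := fun z j => homForm (b j) z with hP
  have hPa : AnalyticAt ℂ P 0 := AnalyticAt.pi fun j => analyticAt_homForm (b j) 0
  have hPd : P =O[𝓝 0] fun z => ‖z‖ ^ d := isBigO_pi.mpr fun j => isBigO_homForm (b j)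
  have h2d : 2 ≤ d := by omega
  have hP2 := hPd.trans (isBigO_norm_pow h2d)
  obtain ⟨H, hconj, hH, hHd⟩ := exists_conjugates_id_add hG.diffeo hPa hP2
  have hdiag (z : Fin n → ℂ) (i : Fin n) : fderiv ℂ H 0 z i = lam i * z i := by
    rw [hHd, hG.diagonal]
  have hnormal : IsNormalUpTo H lam m α k a (p + q) (d + 1) := by
    intro j hj
    have hRP := isBigO_comp_id_add_sub (hRa j) (hN j hj) hP2
    have hQP := isBigO_mul_comp_id_add_sub (analyticAt_resFactor_mon lam a α k p j 0) hPd h2d j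
    rw [mon_zero hα, resFactor_zero hG.one_le] at hQP
    refine (((hRP.add (hbq j hj)).add hQP).sub
      (isBigO_homForm_comp_sub hH hdiag (b j))).congr' ?_ EventuallyEq.rfl
    filter_upwards [hconj.conj] with z hz
    have hzj := congrFun hz j
    simp only [hP, Pi.add_apply] at hzj
    simp only [hR, hP, resFactor, Pi.add_apply, Polynomial.eval_add, hzj]
    ring
  exact ⟨_, H, p + q, hconj, ⟨hH, hdiag, hG.one_le, hG.coeff_ne_zero,
    hnormal.expansion hα (by omega)⟩, hnormal⟩

lemma HasOrder.exists_conjugates_isNormalUpTo {F : (Fin n → ℂ) → Fin n → ℂ}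
    (hF : HasOrder F lam m α k a) (hα : α ≠ 0)
    (hres : ∀ j : Fin n, (j : ℕ) < m → ∀ l,
      IsResonance lam j l → ∃ s : ℕ, l = s • α + Pi.single j 1) (N : ℕ) :
    ∃ φ G p, Conjugates φ F G ∧ IsLeadingForm G lam m α k a ∧
      IsNormalUpTo G lam m α k a p N := by
  suffices h : ∀ e, ∃ φ G p, Conjugates φ F G ∧ IsLeadingForm G lam m α k a ∧
      IsNormalUpTo G lam m α k a p ((∑ i, α i) * k + 2 + e) by
    obtain ⟨φ, G, p, hφ, hG, hp⟩ := h N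
    exact ⟨φ, G, p, hφ, hG, fun j hj => (hp j hj).trans (isBigO_norm_pow (by omega))⟩
  intro e
  induction e with
  | zero =>
    obtain ⟨φ, G, hφ, hG⟩ := hF
    exact ⟨φ, G, 0, hφ, hG, hG.isNormalUpTo⟩
  | succ e ih =>
    obtain ⟨φ, G, p, hφ, hG, hp⟩ := ih
    obtain ⟨ψ, H, p', hψ, hH, hp'⟩ :=
      exists_conjugates_isNormalUpTo_succ hα hres hG (by omega) hp
    exact ⟨φ ∘ ψ, H, p', hφ.trans hψ, hH, hp'⟩

end NormalForm

section FatouCoordinate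

variable {A : ℂ} {k : ℕ} {v : ℂ} {δ τ : ℝ}

/-- The approximate Fatou coordinate of `u + A u^{k+1} + ⋯`. It is normalised without the usual
factor `1 / k`, so that the germ becomes approximately the translation by `k`. -/
noncomputable def fatou (A : ℂ) (k : ℕ) (u : ℂ) : ℂ := -(A * u ^ k)⁻¹

/-- The part of the sector `|Im w| < τ Re w` to the right of `Re w = R`; it is the image of a
petal sector under the Fatou coordinate. -/
def cone (R τ : ℝ) : Set ℂ := {w | R < w.re ∧ |w.im| < τ * w.re}

/-- `v` is one of the `k` unit vectors along which `u ↦ u + A u^{k+1}` attracts, that is, for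
which `A v^k` is a negative real number. -/
def IsAttractingDirection (A : ℂ) (k : ℕ) (v : ℂ) : Prop := v ^ k = -((‖A‖ : ℂ) / A)

/-- The petal sector whose opening is given by the slope `τ` in the Fatou coordinate. -/
noncomputable def coneSector (A : ℂ) (k : ℕ) (δ τ : ℝ) (v : ℂ) : Set ℂ :=
  petalSector A k δ (Real.arctan τ / k) v

/-- The branch of the inverse of the Fatou coordinate with values in the sector around `v`. -/
noncomputable def fatouInv (A : ℂ) (k : ℕ) (v w : ℂ) : ℂ :=
  v * ((‖A‖ : ℂ) * w)⁻¹ ^ ((k : ℂ)⁻¹)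

lemma norm_fatou (A : ℂ) (k : ℕ) (u : ℂ) : ‖fatou A k u‖ = (‖A‖ * ‖u‖ ^ k)⁻¹ := by
  simp [fatou]

lemma continuousAt_fatou (hA : A ≠ 0) {u : ℂ} (hu : u ≠ 0) : ContinuousAt (fatou A k) u := by
  unfold fatou
  refine ContinuousAt.neg (ContinuousAt.inv₀ (by fun_prop) ?_)
  exact mul_ne_zero hA (pow_ne_zero _ hu)

lemma convex_cone (R τ : ℝ) : Convex ℝ (cone R τ) := by
  have h : cone R τ = {w | R < Complex.reLm w} ∩ ({w | 0 < (τ • Complex.reLm - Complex.imLm) w} ∩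
      {w | 0 < (τ • Complex.reLm + Complex.imLm) w}) := by
    ext w
    simp only [cone, abs_lt, Set.mem_ofPred_eq, Set.mem_inter_iff, LinearMap.sub_apply,
      LinearMap.add_apply, LinearMap.smul_apply, Complex.reLm_coe, Complex.imLm_coe, smul_eq_mul]
    constructor <;> rintro ⟨h₁, h₂, h₃⟩ <;> exact ⟨h₁, by linarith, by linarith⟩
  rw [h]
  exact (convex_halfSpace_gt (LinearMap.isLinear _) _).inter
    ((convex_halfSpace_gt (LinearMap.isLinear _) _).inter
      (convex_halfSpace_gt (LinearMap.isLinear _) _))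

lemma ofReal_mem_cone {R x : ℝ} (hτ : 0 < τ) (hR : 0 ≤ R) (hx : R < x) : (x : ℂ) ∈ cone R τ := by
  refine ⟨hx, ?_⟩
  rw [Complex.ofReal_re, Complex.ofReal_im, abs_zero]
  exact mul_pos hτ (hR.trans_lt hx)

lemma norm_le_of_mem_cone {R : ℝ} (hR : 0 ≤ R) {w : ℂ} (hw : w ∈ cone R τ) :
    ‖w‖ ≤ (1 + τ) * w.re := by
  have h := Complex.norm_le_abs_re_add_abs_im w
  rw [abs_of_pos (hR.trans_lt hw.1)] at h
  linarith [hw.2]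

lemma inv_mem_cone_zero {w : ℂ} (hw : w ∈ cone 0 τ) : w⁻¹ ∈ cone 0 τ := by
  have hw0 : w ≠ 0 := by
    rintro rfl
    simpa using hw.1
  have hpos := Complex.normSq_pos.mpr hw0
  refine ⟨?_, ?_⟩
  · rw [Complex.inv_re]
    exact div_pos hw.1 hpos
  · rw [Complex.inv_re, Complex.inv_im, abs_div, abs_neg, abs_of_pos hpos, ← mul_div_assoc]
    exact div_lt_div_of_pos_right hw.2 hpos

lemma norm_add_ofReal_lt_iff {w : ℂ} (hδ : 0 < δ) :
    ‖w + (δ : ℂ)‖ < δ ↔ (2 * δ)⁻¹ < (-w⁻¹).re := by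
  rcases eq_or_ne w 0 with rfl | hw
  · simp [abs_of_pos hδ, hδ.le]
  have hsq : ‖w + (δ : ℂ)‖ < δ ↔ Complex.normSq w + 2 * δ * w.re < 0 := by
    rw [← sq_lt_sq₀ (norm_nonneg _) hδ.le, ← Complex.normSq_eq_norm_sq, Complex.normSq_apply,
      Complex.normSq_apply]
    simp only [Complex.add_re, Complex.ofReal_re, Complex.add_im, Complex.ofReal_im, add_zero]
    constructor <;> intro h <;> nlinarith
  rw [hsq, Complex.neg_re, Complex.inv_re, ← neg_div, lt_div_iff₀ (Complex.normSq_pos.mpr hw),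
    inv_mul_lt_iff₀ (by positivity)]
  constructor <;> intro h <;> linarith

lemma abs_im_lt_iff_abs_arg_lt {w : ℂ} (hw : 0 < w.re) :
    |w.im| < τ * w.re ↔ |w.arg| < Real.arctan τ := by
  have harg : |w.arg| < Real.pi / 2 := Complex.abs_arg_lt_pi_div_two_iff.mpr (Or.inl hw)
  rw [abs_lt] at harg
  have harctan : w.arg = Real.arctan (w.im / w.re) := by
    rw [← Complex.tan_arg, Real.arctan_tan harg.1 harg.2]
  rw [harctan, abs_lt, abs_lt, ← Real.arctan_neg, Real.arctan_strictMono.lt_iff_lt,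
    Real.arctan_strictMono.lt_iff_lt, lt_div_iff₀ hw, div_lt_iff₀ hw, neg_mul]

lemma arg_pow_of_abs_arg_lt {t : ℂ} (hk : 1 ≤ k) (ht : |t.arg| < Real.pi / k) :
    (t ^ k).arg = k * t.arg := by
  have hk' : (0 : ℝ) < k := by exact_mod_cast hk
  have h := congrArg Real.Angle.toReal (Complex.arg_pow_coe_angle t k)
  rw [abs_lt, lt_div_iff₀ hk', ← neg_div, div_lt_iff₀ hk'] at ht
  rwa [← Real.Angle.natCast_mul_eq_nsmul, Complex.arg_coe_angle_toReal_eq_arg,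
    Real.Angle.toReal_coe_eq_self_iff.mpr] at h
  constructor <;> nlinarith

lemma arg_cpow_nat_inv (x : ℂ) (hk : 1 ≤ k) : (x ^ ((k : ℂ)⁻¹)).arg = x.arg / k := by
  have hk' : (1 : ℝ) ≤ k := by exact_mod_cast hk
  rcases eq_or_ne x 0 with rfl | hx
  · rw [Complex.zero_cpow (by simp; omega)]; simp
  have him : (Complex.log x * (k : ℂ)⁻¹).im = x.arg / k := by
    rw [← Complex.ofReal_natCast, ← Complex.ofReal_inv, Complex.im_mul_ofReal, Complex.log_im]
    rfl
  have hgt := Complex.neg_pi_lt_arg x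
  have hle := Complex.arg_le_pi x
  have := Real.pi_pos
  rw [Complex.cpow_def_of_ne_zero hx, ← Complex.log_im, Complex.log_exp, him]
  · rw [him, lt_div_iff₀ (by linarith)]; nlinarith
  · rw [him, div_le_iff₀ (by linarith)]; nlinarith

end FatouCoordinate

section PetalSectors

variable {A : ℂ} {k : ℕ} {v w : ℂ} {δ τ : ℝ}

lemma IsAttractingDirection.ne_zero (hv : IsAttractingDirection A k v) (hA : A ≠ 0)
    (hk : 1 ≤ k) : v ≠ 0 := by
  rintro rfl
  have h := hv.symm
  rw [zero_pow (by omega), neg_eq_zero, div_eq_zero_iff] at h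
  simp [hA] at h

lemma IsAttractingDirection.norm_eq_one (hv : IsAttractingDirection A k v) (hA : A ≠ 0)
    (hk : 1 ≤ k) : ‖v‖ = 1 := by
  have h := congrArg norm hv
  rw [norm_pow, norm_neg, norm_div, Complex.norm_real, norm_norm,
    div_self (norm_ne_zero_iff.mpr hA)] at h
  exact (pow_eq_one_iff_of_nonneg (norm_nonneg _) (by omega)).mp h

lemma IsAttractingDirection.fatou_eq (hv : IsAttractingDirection A k v) (hA : A ≠ 0) (u : ℂ) :
    fatou A k u = ((‖A‖ : ℂ) * (u / v) ^ k)⁻¹ := by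
  have hA' : (‖A‖ : ℂ) ≠ 0 := by simpa using hA
  rw [fatou, div_pow, hv, ← inv_neg]
  congr 1
  field_simp

lemma IsAttractingDirection.abs_arg_fatou (hv : IsAttractingDirection A k v) (hA : A ≠ 0)
    (hk : 1 ≤ k) {u : ℂ} (hu : |(u / v).arg| < Real.pi / k) :
    |(fatou A k u).arg| = k * |(u / v).arg| := by
  rw [hv.fatou_eq hA, Complex.abs_arg_inv, Complex.arg_real_mul _ (norm_pos_iff.mpr hA),
    arg_pow_of_abs_arg_lt hk hu, abs_mul, Nat.abs_cast]

lemma IsAttractingDirection.fatou_fatouInv (hv : IsAttractingDirection A k v) (hA : A ≠ 0)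
    (hk : 1 ≤ k) (w : ℂ) : fatou A k (fatouInv A k v w) = w := by
  have hA' : (‖A‖ : ℂ) ≠ 0 := by simpa using hA
  rw [hv.fatou_eq hA, fatouInv, mul_div_cancel_left₀ _ (hv.ne_zero hA hk),
    Complex.cpow_nat_inv_pow _ (by omega), mul_inv, inv_inv, inv_mul_cancel_left₀ hA']

lemma IsAttractingDirection.fatouInv_fatou (hv : IsAttractingDirection A k v) (hA : A ≠ 0)
    (hk : 1 ≤ k) {u : ℂ} (hu : |(u / v).arg| < Real.pi / k) :
    fatouInv A k v (fatou A k u) = u := by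
  have hA' : (‖A‖ : ℂ) ≠ 0 := by simpa using hA
  have hpow : ((‖A‖ : ℂ) * fatou A k u)⁻¹ = (u / v) ^ k := by
    rw [hv.fatou_eq hA, mul_inv, inv_inv, inv_mul_cancel_left₀ hA']
  rw [abs_lt] at hu
  rw [fatouInv, hpow, Complex.pow_cpow_nat_inv (by omega) hu.1 hu.2.le,
    mul_div_cancel₀ _ (hv.ne_zero hA hk)]

lemma continuousAt_fatouInv (hA : A ≠ 0) (hw : 0 < w.re) : ContinuousAt (fatouInv A k v) w := by
  have hre : 0 < ((‖A‖ : ℂ) * w).re := by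
    rw [Complex.re_ofReal_mul]
    exact mul_pos (norm_pos_iff.mpr hA) hw
  have hne : (‖A‖ : ℂ) * w ≠ 0 := fun h => by simp [h] at hre
  refine continuousAt_const.mul (ContinuousAt.cpow (ContinuousAt.inv₀ (by fun_prop) hne)
    continuousAt_const (Or.inl ?_))
  rw [Complex.inv_re]
  exact div_pos hre (Complex.normSq_pos.mpr hne)

lemma ne_zero_of_mem_petalSector {ε : ℝ} (hk : 1 ≤ k) {u : ℂ}
    (hu : u ∈ petalSector A k δ ε v) : u ≠ 0 := by
  rintro rfl
  have h := hu.1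
  rw [zero_pow (by omega), mul_zero, zero_add, Complex.norm_real, Real.norm_eq_abs] at h
  exact (le_abs_self δ).not_gt h

lemma isOpen_petalSector {ε : ℝ} (hk : 1 ≤ k) (hv : v ≠ 0) (hε : ε ≤ Real.pi) :
    IsOpen (petalSector A k δ ε v) := by
  rw [isOpen_iff_mem_nhds]
  intro u hu
  have hslit : u / v ∈ Complex.slitPlane := by
    rw [Complex.mem_slitPlane_iff_arg]
    refine ⟨fun h => ?_, div_ne_zero (ne_zero_of_mem_petalSector hk hu) hv⟩
    have := hu.2
    rw [h, abs_of_pos Real.pi_pos] at this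
    linarith
  have hdiv : ContinuousAt (fun u : ℂ => u / v) u := by fun_prop
  have harg : ContinuousAt (fun u : ℂ => |(u / v).arg|) u :=
    (ContinuousAt.comp (f := fun u : ℂ => u / v) (Complex.continuousAt_arg hslit) hdiv).abs
  have hnorm : ContinuousAt (fun u : ℂ => ‖A * u ^ k + (δ : ℂ)‖) u := by fun_prop
  filter_upwards [hnorm.eventually_lt_const hu.1, harg.eventually_lt_const hu.2] with w h₁ h₂
  exact ⟨h₁, h₂⟩

lemma eventually_petalSector_subset (hA : A ≠ 0) (k : ℕ) {s : Set ℂ} (hs : s ∈ 𝓝 0) :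
    ∀ᶠ δ in 𝓝[>] (0 : ℝ), ∀ ε v, petalSector A k δ ε v ⊆ s := by
  obtain ⟨r, hr, hball⟩ := Metric.mem_nhds_iff.mp hs
  have hA0 := norm_pos_iff.mpr hA
  have hpos : 0 < ‖A‖ * r ^ k / 2 := by positivity
  filter_upwards [self_mem_nhdsWithin, nhdsWithin_le_nhds (Iio_mem_nhds hpos)]
    with δ hδ hδr ε v u hu
  refine hball (mem_ball_zero_iff.mpr (lt_of_pow_lt_pow_left₀ k hr.le ?_))
  have hlt : ‖A * u ^ k‖ < δ + δ := by
    have h := norm_sub_le (A * u ^ k + (δ : ℂ)) δ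
    rw [add_sub_cancel_right, Complex.norm_real, Real.norm_of_nonneg (le_of_lt hδ)] at h
    linarith [hu.1]
  rw [norm_mul, norm_pow] at hlt
  rw [Set.mem_Iio] at hδr
  exact lt_of_mul_lt_mul_left (by linarith) hA0.le

lemma arctan_div_lt_pi_div (τ : ℝ) (hk : 1 ≤ k) : Real.arctan τ / k < Real.pi / k := by
  have hk' : (0 : ℝ) < k := by exact_mod_cast hk
  exact div_lt_div_of_pos_right
    ((Real.arctan_lt_pi_div_two τ).trans (half_lt_self Real.pi_pos)) hk'

lemma isOpen_coneSector (hv : IsAttractingDirection A k v) (hA : A ≠ 0) (hk : 1 ≤ k) :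
    IsOpen (coneSector A k δ τ v) :=
  isOpen_petalSector hk (hv.ne_zero hA hk) <| (arctan_div_lt_pi_div τ hk).le.trans <|
    div_le_self Real.pi_pos.le (by exact_mod_cast hk)

lemma abs_arg_lt_of_mem_coneSector (hk : 1 ≤ k) {u : ℂ} (hu : u ∈ coneSector A k δ τ v) :
    |(u / v).arg| < Real.pi / k :=
  hu.2.trans (arctan_div_lt_pi_div τ hk)

lemma IsAttractingDirection.mem_coneSector_iff (hv : IsAttractingDirection A k v) (hA : A ≠ 0)
    (hk : 1 ≤ k) (hδ : 0 < δ) {u : ℂ} :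
    u ∈ coneSector A k δ τ v ↔
      fatou A k u ∈ cone (2 * δ)⁻¹ τ ∧ |(u / v).arg| < Real.pi / k := by
  have hk' : (0 : ℝ) < k := by exact_mod_cast hk
  have hδ' : (0 : ℝ) < (2 * δ)⁻¹ := by positivity
  have hopening (harg : |(u / v).arg| < Real.pi / k) (hre : (2 * δ)⁻¹ < (fatou A k u).re) :
      |(u / v).arg| < Real.arctan τ / k ↔
        |(fatou A k u).im| < τ * (fatou A k u).re := by
    rw [abs_im_lt_iff_abs_arg_lt (hδ'.trans hre), hv.abs_arg_fatou hA hk harg, mul_comm,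
      lt_div_iff₀ hk']
  rw [coneSector, petalSector, Set.mem_ofPred_eq, norm_add_ofReal_lt_iff hδ, ← fatou]
  constructor
  · rintro ⟨hre, harg⟩
    have harg' := harg.trans (arctan_div_lt_pi_div τ hk)
    exact ⟨⟨hre, (hopening harg' hre).mp harg⟩, harg'⟩
  · rintro ⟨⟨hre, him⟩, harg⟩
    exact ⟨hre, (hopening harg hre).mpr him⟩

lemma IsAttractingDirection.fatouInv_mem_coneSector (hv : IsAttractingDirection A k v)
    (hA : A ≠ 0) (hk : 1 ≤ k) (hδ : 0 < δ) (hw : w ∈ cone (2 * δ)⁻¹ τ) :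
    fatouInv A k v w ∈ coneSector A k δ τ v := by
  have hkpos : (0 : ℝ) < k := by exact_mod_cast hk
  have hre : 0 < w.re := lt_trans (by positivity) hw.1
  rw [hv.mem_coneSector_iff hA hk hδ, hv.fatou_fatouInv hA hk]
  refine ⟨hw, ?_⟩
  rw [fatouInv, mul_div_cancel_left₀ _ (hv.ne_zero hA hk), arg_cpow_nat_inv _ hk, abs_div,
    Complex.abs_arg_inv, Complex.arg_real_mul _ (norm_pos_iff.mpr hA), abs_of_pos hkpos]
  exact div_lt_div_of_pos_right ((Complex.abs_arg_lt_pi_div_two_iff.mpr (Or.inl hre)).trans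
    (half_lt_self Real.pi_pos)) hkpos

/-- The Fatou coordinate as a homeomorphism from a petal sector onto a cone. -/
noncomputable def coneSectorHomeomorph (hv : IsAttractingDirection A k v) (hA : A ≠ 0)
    (hk : 1 ≤ k) (hδ : 0 < δ) : coneSector A k δ τ v ≃ₜ cone (2 * δ)⁻¹ τ where
  toFun u := ⟨fatou A k u, ((hv.mem_coneSector_iff hA hk hδ).mp u.2).1⟩
  invFun w := ⟨fatouInv A k v w, hv.fatouInv_mem_coneSector hA hk hδ w.2⟩
  left_inv u := Subtype.ext (hv.fatouInv_fatou hA hk (abs_arg_lt_of_mem_coneSector hk u.2))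
  right_inv w := Subtype.ext (hv.fatou_fatouInv hA hk w)
  continuous_toFun := Continuous.subtype_mk (continuous_iff_continuousAt.mpr fun u =>
    (continuousAt_fatou hA (ne_zero_of_mem_petalSector hk u.2)).comp
      continuous_subtype_val.continuousAt) _
  continuous_invFun := Continuous.subtype_mk (continuous_iff_continuousAt.mpr fun w =>
    (continuousAt_fatouInv hA (lt_trans (by positivity) w.2.1)).comp
      continuous_subtype_val.continuousAt) _

lemma simplyConnectedSpace_coneSector (hv : IsAttractingDirection A k v) (hA : A ≠ 0)
    (hk : 1 ≤ k) (hδ : 0 < δ) (hτ : 0 < τ) : SimplyConnectedSpace (coneSector A k δ τ v) := by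
  have hne : (cone (2 * δ)⁻¹ τ).Nonempty :=
    ⟨_, ofReal_mem_cone hτ (by positivity) (lt_add_one (2 * δ)⁻¹)⟩
  have := (convex_cone (2 * δ)⁻¹ τ).contractibleSpace hne
  have := (coneSectorHomeomorph (τ := τ) hv hA hk hδ).contractibleSpace
  infer_instance

lemma disjoint_coneSector (hv : IsAttractingDirection A k v) (hw : IsAttractingDirection A k w)
    (hvw : v ≠ w) (hA : A ≠ 0) (hk : 1 ≤ k) :
    Disjoint (coneSector A k δ τ v) (coneSector A k δ τ w) := by
  rw [Set.disjoint_left]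
  intro u huv huw
  have hu := ne_zero_of_mem_petalSector hk huv
  have h := (hv.fatouInv_fatou hA hk (abs_arg_lt_of_mem_coneSector hk huv)).trans
    (hw.fatouInv_fatou hA hk (abs_arg_lt_of_mem_coneSector hk huw)).symm
  have hne : fatouInv A k v (fatou A k u) ≠ 0 := by
    rwa [hv.fatouInv_fatou hA hk (abs_arg_lt_of_mem_coneSector hk huv)]
  exact hvw (mul_right_cancel₀ (right_ne_zero_of_mul hne) h)

lemma exists_injective_pow_eq (hk : 1 ≤ k) {c : ℂ} (hc : c ≠ 0) :
    ∃ v : Fin k → ℂ, Function.Injective v ∧ ∀ j, v j ^ k = c := by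
  have hk0 : k ≠ 0 := by omega
  have hζ := Complex.isPrimitiveRoot_exp k hk0
  set ζ := Complex.exp (2 * Real.pi * Complex.I / k)
  have hpow : (c ^ ((k : ℂ)⁻¹)) ^ k = c := Complex.cpow_nat_inv_pow c hk0
  have hroot : c ^ ((k : ℂ)⁻¹) ≠ 0 := by
    intro h
    rw [h, zero_pow hk0] at hpow
    exact hc hpow.symm
  refine ⟨fun j => c ^ ((k : ℂ)⁻¹) * ζ ^ (j : ℕ), fun i j hij => ?_, fun j => ?_⟩
  · exact Fin.ext (hζ.pow_inj i.2 j.2 (mul_left_cancel₀ hroot hij))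
  · rw [mul_pow, hpow, ← pow_mul, mul_comm (j : ℕ), pow_mul, hζ.pow_eq_one, one_pow, mul_one]

lemma exists_injective_isAttractingDirection (hA : A ≠ 0) (hk : 1 ≤ k) :
    ∃ v : Fin k → ℂ, Function.Injective v ∧ ∀ j, IsAttractingDirection A k (v j) :=
  exists_injective_pow_eq hk (neg_ne_zero.mpr (div_ne_zero (by simpa using hA) hA))

lemma coneSector_mem_nhdsWithin (hv : IsAttractingDirection A k v) (hA : A ≠ 0) (hk : 1 ≤ k)
    (hδ : 0 < δ) {δ' : ℝ} (hδ' : 0 < δ') :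
    coneSector A k δ' τ v ∈ 𝓝[coneSector A k δ τ v] 0 := by
  have hlim : Tendsto (fun u : ℂ => (1 + τ) * (2 * δ')⁻¹ * (‖A‖ * ‖u‖ ^ k)) (𝓝 0) (𝓝 0) :=
    Continuous.tendsto' (by fun_prop) _ _ (by simp [Nat.one_le_iff_ne_zero.mp hk])
  filter_upwards [self_mem_nhdsWithin, nhdsWithin_le_nhds (hlim.eventually_lt_const one_pos)]
    with u hu hsmall
  obtain ⟨hcone, harg⟩ := (hv.mem_coneSector_iff hA hk hδ).mp hu
  refine (hv.mem_coneSector_iff hA hk hδ').mpr ⟨⟨?_, hcone.2⟩, harg⟩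
  have hre : 0 < (fatou A k u).re := lt_trans (by positivity) hcone.1
  have hnorm := norm_le_of_mem_cone (by positivity) hcone
  have hu0 := norm_pos_iff.mpr (ne_zero_of_mem_petalSector hk hu)
  have hA0 := norm_pos_iff.mpr hA
  rw [← lt_div_iff₀ (by positivity), one_div, ← norm_fatou] at hsmall
  have hτ : 0 < τ := pos_of_mul_pos_left ((abs_nonneg _).trans_lt hcone.2) hre.le
  exact lt_of_mul_lt_mul_left (hsmall.trans_le hnorm) (by positivity)

end PetalSectors

section Perturbations

variable {A : ℂ} {k : ℕ}

lemma norm_div_sub_one_sub_le {c : ℝ} {u u' : ℂ} (hu : u ≠ 0)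
    (h : ‖u' - (u + A * u ^ (k + 1))‖ ≤ c * ‖u‖ ^ (k + 1)) :
    ‖u' / u - 1 - A * u ^ k‖ ≤ c * ‖u‖ ^ k := by
  have heq : u' / u - 1 - A * u ^ k = (u' - (u + A * u ^ (k + 1))) / u := by
    field_simp
    ring
  rwa [heq, norm_div, div_le_iff₀ (norm_pos_iff.mpr hu), mul_assoc, ← pow_succ]

lemma norm_le_of_norm_sub_mul_pow_le {c : ℝ} {u x : ℂ} (h : ‖x - A * u ^ k‖ ≤ c * ‖u‖ ^ k) :
    ‖x‖ ≤ (‖A‖ + c) * ‖u‖ ^ k := by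
  calc ‖x‖ = ‖A * u ^ k + (x - A * u ^ k)‖ := by rw [add_sub_cancel]
    _ ≤ ‖A * u ^ k‖ + ‖x - A * u ^ k‖ := norm_add_le _ _
    _ ≤ ‖A‖ * ‖u‖ ^ k + c * ‖u‖ ^ k := by rw [norm_mul, norm_pow]; gcongr
    _ = (‖A‖ + c) * ‖u‖ ^ k := by ring

lemma eventually_forall_norm_sub_le (hk : 1 ≤ k) (A : ℂ) (c : ℝ) {p : ℂ → Prop}
    (hp : ∀ᶠ x in 𝓝 0, p x) :
    ∀ᶠ u : ℂ in 𝓝 0, ∀ x, ‖x - A * u ^ k‖ ≤ c * ‖u‖ ^ k → p x := by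
  obtain ⟨r, hr, hball⟩ := Metric.eventually_nhds_iff.mp hp
  have hlim : Tendsto (fun u : ℂ => (‖A‖ + c) * ‖u‖ ^ k) (𝓝 0) (𝓝 0) :=
    Continuous.tendsto' (by fun_prop) _ _ (by simp [Nat.one_le_iff_ne_zero.mp hk])
  filter_upwards [hlim.eventually_lt_const hr] with u hu x hx
  refine hball ?_
  rw [dist_zero_right]
  exact (norm_le_of_norm_sub_mul_pow_le hx).trans_lt hu

lemma exists_norm_sub_fderiv_le {E : Type*} [NormedAddCommGroup E] [NormedSpace ℝ E]
    (hk : 1 ≤ k) (A : ℂ) {f : ℂ → E} {L : ℂ →L[ℝ] E} (hf : HasFDerivAt f L 0) {η : ℝ}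
    (hη : 0 < η) :
    ∃ c > 0, ∀ᶠ u : ℂ in 𝓝 0, ∀ x, ‖x - A * u ^ k‖ ≤ c * ‖u‖ ^ k →
      ‖f x - f 0 - L (A * u ^ k)‖ ≤ η * ‖u‖ ^ k := by
  set c : ℝ := min 1 (η / (2 * (‖L‖ + 1)))
  have hLc : ‖L‖ * c ≤ η / 2 := by
    calc ‖L‖ * c ≤ (‖L‖ + 1) * (η / (2 * (‖L‖ + 1))) := by
          gcongr
          · linarith
          · exact min_le_right _ _
      _ = η / 2 := by field_simp
  have hlittle : ∀ᶠ x in 𝓝 (0 : ℂ), ‖f x - f 0 - L x‖ ≤ η / (2 * (‖A‖ + 1)) * ‖x‖ := by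
    simpa using (hasFDerivAt_iff_isLittleO_nhds_zero.mp hf).def
      (show 0 < η / (2 * (‖A‖ + 1)) by positivity)
  refine ⟨c, by positivity, ?_⟩
  filter_upwards [eventually_forall_norm_sub_le hk A c hlittle] with u hu x hx
  calc ‖f x - f 0 - L (A * u ^ k)‖
      = ‖(f x - f 0 - L x) + L (x - A * u ^ k)‖ := by rw [map_sub]; congr 1; abel
    _ ≤ ‖f x - f 0 - L x‖ + ‖L‖ * ‖x - A * u ^ k‖ := norm_add_le_of_le le_rfl (L.le_opNorm _)
    _ ≤ η / (2 * (‖A‖ + 1)) * ((‖A‖ + 1) * ‖u‖ ^ k) + ‖L‖ * (c * ‖u‖ ^ k) := by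
        gcongr
        refine (hu x hx).trans ?_
        gcongr
        refine (norm_le_of_norm_sub_mul_pow_le hx).trans ?_
        gcongr
        exact min_le_left _ _
    _ = (η / 2 + ‖L‖ * c) * ‖u‖ ^ k := by field_simp
    _ ≤ η * ‖u‖ ^ k := by gcongr; linarith

end Perturbations

section FatouStep

variable {A : ℂ} {k : ℕ} {v : ℂ} {δ τ : ℝ}

lemma eventually_abs_arg_div_lt (hk : 1 ≤ k) (A : ℂ) (c : ℝ) {η : ℝ} (hη : 0 < η) :
    ∀ᶠ u in 𝓝[≠] 0, ∀ u', ‖u' - (u + A * u ^ (k + 1))‖ ≤ c * ‖u‖ ^ (k + 1) →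
      u' ≠ 0 ∧ |(u' / u).arg| < η := by
  have hadd : ContinuousAt (fun x : ℂ => 1 + x) 0 := by fun_prop
  have harg : ContinuousAt (fun x : ℂ => |(1 + x).arg|) 0 :=
    (ContinuousAt.comp (f := fun x : ℂ => 1 + x)
      (Complex.continuousAt_arg (by simp)) hadd).abs
  have hnear : ∀ᶠ x : ℂ in 𝓝 0, 1 + x ≠ 0 ∧ |(1 + x).arg| < η :=
    (hadd.eventually_ne (by simp)).and (harg.eventually_lt_const (by simpa using hη))
  filter_upwards [self_mem_nhdsWithin,
    nhdsWithin_le_nhds (eventually_forall_norm_sub_le hk A c hnear)] with u hu hstep u' hu'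
  have h := hstep _ (norm_div_sub_one_sub_le hu hu')
  rw [add_sub_cancel] at h
  exact ⟨fun h0 => h.1 (by rw [h0, zero_div]), h.2⟩

lemma exists_norm_fatou_sub_le (hA : A ≠ 0) (hk : 1 ≤ k) {η : ℝ} (hη : 0 < η) :
    ∃ c > 0, ∀ᶠ u in 𝓝[≠] 0, ∀ u', ‖u' - (u + A * u ^ (k + 1))‖ ≤ c * ‖u‖ ^ (k + 1) →
      ‖fatou A k u' - fatou A k u - k‖ ≤ η := by
  have hA0 := norm_pos_iff.mpr hA
  have hderiv : HasDerivAt (fun x : ℂ => ((1 + x) ^ k)⁻¹) (-(k : ℂ)) 0 := by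
    have h : HasDerivAt (fun x : ℂ => (1 + x) ^ k) ((k : ℂ) * (1 + 0) ^ (k - 1) * 1) 0 :=
      ((hasDerivAt_id (0 : ℂ)).const_add 1).pow k
    simpa using h.fun_inv (by simp)
  obtain ⟨c, hc, hstep⟩ := exists_norm_sub_fderiv_le hk A
    (hderiv.hasFDerivAt.restrictScalars ℝ) (mul_pos hη hA0)
  refine ⟨c, hc, ?_⟩
  filter_upwards [self_mem_nhdsWithin, nhdsWithin_le_nhds hstep] with u hu hstep u' hu'
  have h := hstep _ (norm_div_sub_one_sub_le hu hu')
  have hAu : A * u ^ k ≠ 0 := mul_ne_zero hA (pow_ne_zero _ hu)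
  have heq : fatou A k u' - fatou A k u - k =
      fatou A k u * (((u' / u) ^ k)⁻¹ - 1 + A * u ^ k * k) := by
    have hu' : fatou A k u' = fatou A k u * ((u' / u) ^ k)⁻¹ := by
      rw [fatou, fatou, neg_mul, ← mul_inv, mul_assoc, ← mul_pow, mul_div_cancel₀ _ hu]
    have hinv : fatou A k u * (A * u ^ k) = -1 := by
      rw [fatou, neg_mul, inv_mul_cancel₀ hAu]
    rw [hu']
    linear_combination (-(k : ℂ)) * hinv
  have : 0 < ‖u‖ := norm_pos_iff.mpr hu
  rw [heq, norm_mul, norm_fatou, inv_mul_le_iff₀ (by positivity)]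
  calc _ ≤ η * ‖A‖ * ‖u‖ ^ k := by simpa [sub_neg_eq_add] using h
    _ = ‖A‖ * ‖u‖ ^ k * η := by ring

lemma tendsto_fatou_comp_sub (hA : A ≠ 0) (hk : 1 ≤ k) {h : ℂ → ℂ}
    (hh : (fun u : ℂ => h u - (u + A * u ^ (k + 1))) =o[𝓝 0] fun u => ‖u‖ ^ (k + 1)) :
    Tendsto (fun u => fatou A k (h u) - fatou A k u) (𝓝[≠] 0) (𝓝 (k : ℂ)) := by
  rw [Metric.tendsto_nhds]
  intro η hη
  obtain ⟨c, hc, hstep⟩ := exists_norm_fatou_sub_le hA hk (half_pos hη)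
  filter_upwards [hstep, nhdsWithin_le_nhds (hh.def hc)] with u hu hsmall
  rw [norm_pow, norm_norm] at hsmall
  rw [dist_eq_norm]
  exact (hu _ hsmall).trans_lt (half_lt_self hη)

lemma add_mem_cone {R η : ℝ} {w w' : ℂ} (hw : w ∈ cone R τ) (hτ : 0 ≤ τ) (hη : η ≤ 1 / 2)
    (hητ : η ≤ τ / 2) (hk : 1 ≤ k) (hw' : ‖w' - w - k‖ ≤ η) :
    w' ∈ cone R τ ∧ w.re + 1 / 2 ≤ w'.re := by
  have hk' : (1 : ℝ) ≤ k := by exact_mod_cast hk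
  have hre := (Complex.abs_re_le_norm _).trans hw'
  have him := (Complex.abs_im_le_norm _).trans hw'
  simp only [Complex.sub_re, Complex.sub_im, Complex.natCast_re, Complex.natCast_im,
    sub_zero] at hre him
  have hstep : w.re + 1 / 2 ≤ w'.re := by linarith [(abs_le.mp hre).1]
  refine ⟨⟨by linarith [hw.1], ?_⟩, hstep⟩
  calc |w'.im| ≤ |w'.im - w.im| + |w.im| := by
        simpa using abs_add_le (w'.im - w.im) w.im
    _ < τ / 2 + τ * w.re := add_lt_add_of_le_of_lt (him.trans hητ) hw.2
    _ = τ * (w.re + 1 / 2) := by ring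
    _ ≤ τ * w'.re := by gcongr

lemma exists_coneSector_step (hA : A ≠ 0) (hk : 1 ≤ k) (hτ : 0 < τ) :
    ∃ c > 0, ∀ᶠ u in 𝓝 0, ∀ v, IsAttractingDirection A k v → ∀ δ > 0,
      u ∈ coneSector A k δ τ v → ∀ u', ‖u' - (u + A * u ^ (k + 1))‖ ≤ c * ‖u‖ ^ (k + 1) →
        u' ∈ coneSector A k δ τ v ∧ (fatou A k u).re + 1 / 2 ≤ (fatou A k u').re := by
  have hk' : (1 : ℝ) ≤ k := by exact_mod_cast hk
  have hpi := Real.pi_pos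
  obtain ⟨c, hc, hfatou⟩ := exists_norm_fatou_sub_le hA hk
    (show 0 < min (1 / 2) (τ / 2) by positivity)
  refine ⟨c, hc, ?_⟩
  filter_upwards [eventually_nhdsWithin_iff.mp hfatou, eventually_nhdsWithin_iff.mp
    (eventually_abs_arg_div_lt hk A c (show 0 < Real.pi / 2 / k by positivity))]
    with u hfatou harg v hv δ hδ hu u' hu'
  have hu0 := ne_zero_of_mem_petalSector hk hu
  have hv0 := hv.ne_zero hA hk
  obtain ⟨hu'0, harg⟩ := harg hu0 u' hu'
  obtain ⟨hcone', hre⟩ := add_mem_cone ((hv.mem_coneSector_iff hA hk hδ).mp hu).1 hτ.le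
    (min_le_left _ _) (min_le_right _ _) hk (hfatou hu0 u' hu')
  refine ⟨(hv.mem_coneSector_iff hA hk hδ).mpr ⟨hcone', ?_⟩, hre⟩
  have hsum : |(u' / u).arg + (u / v).arg| < Real.pi / k := by
    have huv : |(u / v).arg| < Real.pi / 2 / k :=
      hu.2.trans (div_lt_div_of_pos_right (Real.arctan_lt_pi_div_two τ) (by linarith))
    calc _ ≤ |(u' / u).arg| + |(u / v).arg| := abs_add_le _ _
      _ < Real.pi / 2 / k + Real.pi / 2 / k := add_lt_add harg huv
      _ = Real.pi / k := by ring
  have hle : Real.pi / k ≤ Real.pi := div_le_self hpi.le hk'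
  have hmul : u' / v = (u' / u) * (u / v) := by field_simp
  rwa [hmul, (Complex.arg_mul_eq_add_arg_iff (div_ne_zero hu'0 hu0)
    (div_ne_zero hu0 hv0)).mpr]
  rw [abs_lt] at hsum
  exact ⟨by linarith, by linarith⟩

end FatouStep

section Petals

variable {A : ℂ} {k : ℕ} {v : ℂ} {δ τ : ℝ}

lemma tendsto_zero_of_tendsto_fatou (hA : A ≠ 0) {x : ℕ → ℂ}
    (hx : Tendsto (fun q => (fatou A k (x q)).re) atTop atTop) : Tendsto x atTop (𝓝 0) := by
  have := norm_pos_iff.mpr hA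
  rw [Metric.tendsto_nhds]
  intro r hr
  filter_upwards [hx.eventually_gt_atTop (‖A‖ * r ^ k)⁻¹] with q hq
  rw [dist_zero_right]
  by_contra! hle
  have hlt := hq.trans_le (Complex.re_le_norm _)
  rw [norm_fatou] at hlt
  exact hlt.not_ge (by gcongr)

lemma tendsto_atTop_of_add_half_le {x : ℕ → ℝ} (hx : ∀ q, x q + 1 / 2 ≤ x (q + 1)) :
    Tendsto x atTop atTop := by
  have h (q : ℕ) : x 0 + q * (1 / 2) ≤ x q := by
    induction q with
    | zero => simp
    | succ q ih => push_cast; linarith [hx q]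
  exact tendsto_atTop_mono h <| tendsto_atTop_add_const_left _ _ <|
    tendsto_natCast_atTop_atTop.atTop_mul_const (by norm_num)

lemma tendsto_arg_of_tendsto_sub {w : ℕ → ℂ} {c : ℂ} (hc : c ∈ Complex.slitPlane)
    (hw : Tendsto (fun q => w (q + 1) - w q) atTop (𝓝 c)) :
    Tendsto (fun q => (w q).arg) atTop (𝓝 c.arg) := by
  have hmean : Tendsto (fun q : ℕ => (q : ℝ)⁻¹ • w q) atTop (𝓝 c) := by
    have hconst : Tendsto (fun q : ℕ => (q : ℝ)⁻¹ • w 0) atTop (𝓝 0) := by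
      simpa using (tendsto_inv_atTop_nhds_zero_nat (𝕜 := ℝ)).smul_const (w 0)
    have hsum := hw.cesaro_smul.add hconst
    rw [add_zero] at hsum
    refine hsum.congr fun q => ?_
    rw [Finset.sum_range_sub, ← smul_add, sub_add_cancel]
  refine ((Complex.continuousAt_arg hc).tendsto.comp hmean).congr' ?_
  filter_upwards [eventually_gt_atTop 0] with q hq
  rw [Function.comp_apply, Complex.real_smul, Complex.arg_real_mul _ (by positivity)]

lemma IsAttractingDirection.tendsto_div_norm (hv : IsAttractingDirection A k v) (hA : A ≠ 0)
    (hk : 1 ≤ k) {x : ℕ → ℂ} (hx : ∀ q, x q ∈ coneSector A k δ τ v)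
    (hdiff : Tendsto (fun q => fatou A k (x (q + 1)) - fatou A k (x q)) atTop (𝓝 (k : ℂ))) :
    Tendsto (fun q => x q / (‖x q‖ : ℂ)) atTop (𝓝 v) := by
  have hk' : (1 : ℝ) ≤ k := by exact_mod_cast hk
  have hfatou : Tendsto (fun q => (fatou A k (x q)).arg) atTop (𝓝 0) := by
    have h := tendsto_arg_of_tendsto_sub (w := fun q => fatou A k (x q))
      (Complex.natCast_mem_slitPlane.mpr (by omega)) hdiff
    rwa [Complex.natCast_arg] at h
  have harg : Tendsto (fun q => (x q / v).arg) atTop (𝓝 0) := by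
    refine squeeze_zero_norm (fun q => ?_) (tendsto_zero_iff_abs_tendsto_zero _ |>.mp hfatou)
    rw [Function.comp_apply, Real.norm_eq_abs,
      hv.abs_arg_fatou hA hk (abs_arg_lt_of_mem_coneSector hk (hx q))]
    exact le_mul_of_one_le_left (abs_nonneg _) hk'
  have hexp : Tendsto (fun q => v * Complex.exp ((x q / v).arg * Complex.I)) atTop (𝓝 v) := by
    have hcont : Continuous fun t : ℝ => v * Complex.exp ((t : ℂ) * Complex.I) := by fun_prop
    simpa [Function.comp_def] using (hcont.tendsto 0).comp harg
  refine hexp.congr fun q => ?_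
  have hx0 : (‖x q‖ : ℂ) ≠ 0 := by simpa using ne_zero_of_mem_petalSector hk (hx q)
  have hpolar := Complex.norm_mul_exp_arg_mul_I (x q / v)
  rw [norm_div, hv.norm_eq_one hA hk, div_one, eq_div_iff (hv.ne_zero hA hk)] at hpolar
  rw [eq_div_iff hx0]
  linear_combination hpolar

lemma zero_mem_closure_coneSector (hv : IsAttractingDirection A k v) (hA : A ≠ 0) (hk : 1 ≤ k)
    (hδ : 0 < δ) (hτ : 0 < τ) : (0 : ℂ) ∈ closure (coneSector A k δ τ v) := by
  have hlim : Tendsto (fun q : ℕ => fatouInv A k v ((q + 1 + (2 * δ)⁻¹ : ℝ) : ℂ)) atTop (𝓝 0) := by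
    refine tendsto_zero_of_tendsto_fatou (k := k) hA ?_
    simp only [hv.fatou_fatouInv hA hk, Complex.ofReal_re]
    exact tendsto_atTop_add_const_right _ _
      (tendsto_atTop_add_const_right _ _ tendsto_natCast_atTop_atTop)
  refine mem_closure_of_tendsto hlim (Eventually.of_forall fun q => ?_)
  exact hv.fatouInv_mem_coneSector hA hk hδ
    (ofReal_mem_cone hτ (by positivity) (lt_add_of_pos_left _ (by positivity)))

lemma eventually_isAttractingPetal (hA : A ≠ 0) (hk : 1 ≤ k) (hτ : 0 < τ) {h : ℂ → ℂ}
    (ha : AnalyticAt ℂ h 0)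
    (hh : (fun u : ℂ => h u - (u + A * u ^ (k + 1))) =o[𝓝 0] fun u => ‖u‖ ^ (k + 1)) :
    ∀ᶠ δ in 𝓝[>] (0 : ℝ), ∀ v, IsAttractingDirection A k v →
      IsAttractingPetal h v (coneSector A k δ τ v) := by
  obtain ⟨c, hc, hstep⟩ := exists_coneSector_step hA hk hτ
  have hsmall := hh.def hc
  simp only [norm_pow, norm_norm] at hsmall
  filter_upwards [self_mem_nhdsWithin, eventually_petalSector_subset hA k
    ((hstep.and hsmall).and ha.eventually_analyticAt)] with δ hδ hsub v hv
  set S := coneSector A k δ τ v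
  have hone (u : ℂ) (hu : u ∈ S) :
      h u ∈ S ∧ (fatou A k u).re + 1 / 2 ≤ (fatou A k (h u)).re := by
    obtain ⟨⟨hstep, hsmall⟩, -⟩ := hsub _ _ hu
    exact hstep v hv δ hδ hu (h u) hsmall
  have hmaps : Set.MapsTo h S S := fun u hu => (hone u hu).1
  have hiter (u : ℂ) (hu : u ∈ S) (q : ℕ) : h^[q] u ∈ S := hmaps.iterate q hu
  have hne (u : ℂ) (hu : u ∈ S) (q : ℕ) : h^[q] u ≠ 0 :=
    ne_zero_of_mem_petalSector hk (hiter u hu q)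
  have hzero (u : ℂ) (hu : u ∈ S) : Tendsto (fun q => h^[q] u) atTop (𝓝 0) := by
    refine tendsto_zero_of_tendsto_fatou (k := k) hA (tendsto_atTop_of_add_half_le fun q => ?_)
    rw [Function.iterate_succ_apply']
    exact (hone _ (hiter u hu q)).2
  have hopen : IsOpen S := isOpen_coneSector hv hA hk
  refine ⟨hopen, simplyConnectedSpace_coneSector hv hA hk hδ hτ, ?_,
    fun u hu => (hsub _ _ hu).2, hmaps, hzero, hne, fun u hu => ?_⟩
  · rw [hopen.frontier_eq]
    exact ⟨zero_mem_closure_coneSector hv hA hk hδ hτ,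
      fun h0 => ne_zero_of_mem_petalSector hk h0 rfl⟩
  · refine hv.tendsto_div_norm hA hk (hiter u hu) ?_
    simp only [Function.iterate_succ_apply']
    exact (tendsto_fatou_comp_sub hA hk hh).comp
      (tendsto_nhdsWithin_iff.mpr ⟨hzero u hu, Eventually.of_forall (hne u hu)⟩)

end Petals

section InducedGerm

variable {n m k N : ℕ} {lam a : Fin n → ℂ} {α : Fin n → ℕ} {p : Fin n → Polynomial ℂ}

lemma isBigO_mul_expansion (hk : 1 ≤ k) {f g : ℂ → ℂ} {c d b e : ℂ}
    (hf : (fun u => f u - c * (1 + b * u ^ k)) =O[𝓝 0] fun u => ‖u‖ ^ (k + 1))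
    (hg : (fun u => g u - d * (1 + e * u ^ k)) =O[𝓝 0] fun u => ‖u‖ ^ (k + 1)) :
    (fun u => f u * g u - c * d * (1 + (b + e) * u ^ k)) =O[𝓝 0] fun u => ‖u‖ ^ (k + 1) := by
  have hone (c b : ℂ) : (fun u : ℂ => c * (1 + b * u ^ k)) =O[𝓝 0] fun _ => (1 : ℝ) :=
    Tendsto.isBigO_one ℝ (ContinuousAt.tendsto (by fun_prop))
  have hg_one : g =O[𝓝 0] fun _ => (1 : ℝ) := by
    simpa using (hg.trans ((isBigO_norm_pow (Nat.zero_le _)).congr_right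
      fun _ => pow_zero _)).add (hone d e)
  have hfg : (fun u => (f u - c * (1 + b * u ^ k)) * g u) =O[𝓝 0] fun u => ‖u‖ ^ (k + 1) :=
    (hf.mul hg_one).congr_right fun _ => mul_one _
  have hgf : (fun u => c * (1 + b * u ^ k) * (g u - d * (1 + e * u ^ k))) =O[𝓝 0]
      fun u => ‖u‖ ^ (k + 1) :=
    ((hone c b).mul hg).congr_right fun _ => one_mul _
  have hsq : (fun u : ℂ => c * d * b * e * u ^ (k + k)) =O[𝓝 0] fun u => ‖u‖ ^ (k + 1) :=
    (((isBigO_refl _ _).norm_right.congr_right fun _ => norm_pow _ _).trans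
      (isBigO_norm_pow (by omega))).const_mul_left _
  refine ((hfg.add hgf).add hsq).congr_left fun u => ?_
  ring

lemma isBigO_pow_expansion (hk : 1 ≤ k) {f : ℂ → ℂ} {c b : ℂ}
    (hf : (fun u => f u - c * (1 + b * u ^ k)) =O[𝓝 0] fun u => ‖u‖ ^ (k + 1)) (i : ℕ) :
    (fun u => f u ^ i - c ^ i * (1 + i * b * u ^ k)) =O[𝓝 0] fun u => ‖u‖ ^ (k + 1) := by
  induction i with
  | zero => simpa using isBigO_zero _ _
  | succ i ih =>
    refine (isBigO_mul_expansion hk ih hf).congr_left fun u => ?_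
    push_cast
    ring

lemma isBigO_prod_expansion (hk : 1 ≤ k) {ι : Type*} (s : Finset ι) {f : ι → ℂ → ℂ}
    {c b : ι → ℂ}
    (hf : ∀ i ∈ s, (fun u => f i u - c i * (1 + b i * u ^ k)) =O[𝓝 0] fun u => ‖u‖ ^ (k + 1)) :
    (fun u => ∏ i ∈ s, f i u - (∏ i ∈ s, c i) * (1 + (∑ i ∈ s, b i) * u ^ k)) =O[𝓝 0]
      fun u => ‖u‖ ^ (k + 1) := by
  classical
  induction s using Finset.induction_on with
  | empty => simpa using isBigO_zero _ _
  | insert i s hi ih =>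
    rw [Finset.forall_mem_insert] at hf
    simpa only [Finset.prod_insert hi, Finset.sum_insert hi] using
      isBigO_mul_expansion hk hf.1 (ih hf.2)

lemma isBigO_resFactor_expansion (a : Fin n → ℂ) (k : ℕ) (p : Fin n → Polynomial ℂ) {j : Fin n}
    (hj : lam j ≠ 0) :
    (fun u => resFactor lam a k p j u - lam j * (1 + a j / lam j * u ^ k)) =O[𝓝 0]
      fun u => ‖u‖ ^ (k + 1) := by
  have hp : (fun u : ℂ => (p j).eval u) =O[𝓝 0] fun _ => (1 : ℝ) :=
    (p j).continuous.continuousAt.isBigO_one ℝ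
  have hpow : (fun u : ℂ => u ^ (k + 1)) =O[𝓝 0] fun u => ‖u‖ ^ (k + 1) :=
    (isBigO_refl _ _).norm_right.congr_right fun _ => norm_pow _ _
  refine (hpow.mul hp).congr (fun u => ?_) fun _ => mul_one _
  rw [resFactor]
  field_simp
  ring

lemma bigLam_eq_sum (hα : ∀ j : Fin n, m ≤ (j : ℕ) → α j = 0) :
    bigLam lam m α a = ∑ j, α j * (a j / lam j) := by
  refine Finset.sum_congr rfl fun j _ => ?_
  split_ifs with hj
  · ring
  · simp [hα j (not_lt.mp hj)]

/-- The germ `u ∏ⱼ gⱼ(u)^{αⱼ}` which the resonant normal form `z_j ↦ z_j g_j(z^α)` induces on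
`u = z^α`. -/
noncomputable def inducedGerm (lam a : Fin n → ℂ) (α : Fin n → ℕ) (k : ℕ)
    (p : Fin n → Polynomial ℂ) (u : ℂ) : ℂ :=
  u * ∏ j, resFactor lam a k p j u ^ α j

lemma analyticAt_inducedGerm (lam a : Fin n → ℂ) (α : Fin n → ℕ) (k : ℕ)
    (p : Fin n → Polynomial ℂ) (u₀ : ℂ) : AnalyticAt ℂ (inducedGerm lam a α k p) u₀ :=
  analyticAt_id.mul (Finset.analyticAt_fun_prod _ fun j _ =>
    (analyticAt_resFactor lam a k p j u₀).pow _)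

lemma isBigO_inducedGerm_sub (hk : 1 ≤ k) (a : Fin n → ℂ) (p : Fin n → Polynomial ℂ)
    (hα : ∀ j : Fin n, m ≤ (j : ℕ) → α j = 0) (hlam : ∀ j : Fin n, (j : ℕ) < m → lam j ≠ 0)
    (hmon : mon α lam = 1) :
    (fun u : ℂ => inducedGerm lam a α k p u - (u + bigLam lam m α a * u ^ (k + 1))) =O[𝓝 0]
      fun u => ‖u‖ ^ (k + 2) := by
  have hfactor (j : Fin n) : (fun u => resFactor lam a k p j u ^ α j -
      lam j ^ α j * (1 + α j * (a j / lam j) * u ^ k)) =O[𝓝 0] fun u => ‖u‖ ^ (k + 1) := by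
    rcases lt_or_ge (j : ℕ) m with hj | hj
    · exact isBigO_pow_expansion hk (isBigO_resFactor_expansion a k p (hlam j hj)) _
    · simpa [hα j hj] using isBigO_zero _ _
  have hprod := isBigO_prod_expansion hk Finset.univ fun j _ => hfactor j
  rw [← bigLam_eq_sum hα, ← mon, hmon] at hprod
  refine ((isBigO_refl (fun u : ℂ => u) (𝓝 0)).norm_right.mul hprod).congr (fun u => ?_)
    fun u => ?_
  · rw [inducedGerm]
    ring
  · ring

lemma isBigO_mon_sub_mon {E : Type*} {l : Filter E} {g : E → ℝ} {x y : E → Fin n → ℂ}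
    (hx : ∀ j, α j ≠ 0 → Tendsto (fun z => x z j) l (𝓝 0))
    (hy : ∀ j, α j ≠ 0 → Tendsto (fun z => y z j) l (𝓝 0))
    (hxy : ∀ j, α j ≠ 0 → (fun z => x z j - y z j) =O[l] g) :
    (fun z => mon α (x z) - mon α (y z)) =O[l] g := by
  let T : (Fin n → ℂ) → Fin n → ℂ := fun w j => if α j = 0 then 0 else w j
  have hmon (w : Fin n → ℂ) : mon α (T w) = mon α w := by
    refine Finset.prod_congr rfl fun j _ => ?_
    by_cases hj : α j = 0 <;> simp [T, hj]
  have hT {x : E → Fin n → ℂ} (hx : ∀ j, α j ≠ 0 → Tendsto (fun z => x z j) l (𝓝 0)) :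
      Tendsto (fun z => T (x z)) l (𝓝 0) := by
    refine tendsto_pi_nhds.mpr fun j => ?_
    by_cases hj : α j = 0
    · simpa [T, hj] using tendsto_const_nhds
    · simpa [T, hj] using hx j hj
  have hTxy : (fun z => T (x z) - T (y z)) =O[l] g := by
    refine isBigO_pi.mpr fun j => ?_
    by_cases hj : α j = 0
    · simpa [T, hj] using isBigO_zero _ _
    · simpa [T, hj] using hxy j hj
  refine (((analyticAt_mon α 0).hasStrictFDerivAt.isBigO_sub.comp_tendsto
    ((hT hx).prodMk_nhds (hT hy))).trans hTxy).congr_left fun z => ?_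
  simp only [Function.comp_apply, hmon]

lemma IsNormalUpTo.isBigO_mon_comp_sub_inducedGerm {G : (Fin n → ℂ) → (Fin n → ℂ)}
    (hG : IsNormalUpTo G lam m α k a p N) (hGd : IsGermDiffeo G)
    (hα : ∀ j : Fin n, m ≤ (j : ℕ) → α j = 0) :
    (fun z : Fin n → ℂ => mon α (G z) - inducedGerm lam a α k p (mon α z)) =O[𝓝 0]
      fun z => ‖z‖ ^ N := by
  have hnormal (j : Fin n) :
      Tendsto (fun z : Fin n → ℂ => z j * resFactor lam a k p j (mon α z)) (𝓝 0) (𝓝 0) := by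
    have hcont : ContinuousAt (fun z => z j * resFactor lam a k p j (mon α z)) 0 :=
      ((analyticAt_apply j 0).mul (analyticAt_resFactor_mon lam a α k p j 0)).continuousAt
    simpa [ContinuousAt] using hcont
  refine (isBigO_mon_sub_mon (y := fun z j => z j * resFactor lam a k p j (mon α z))
    (fun j _ => tendsto_pi_nhds.mp hGd.tendsto j) (fun j _ => hnormal j)
    fun j hj => hG j (not_le.mp fun hmj => hj (hα j hmj))).congr_left fun z => ?_
  simp only [inducedGerm, mon, mul_pow, Finset.prod_mul_distrib]

end InducedGerm

section BasinStep

variable {n k N : ℕ} {G : (Fin n → ℂ) → (Fin n → ℂ)} {lam a : Fin n → ℂ} {α : Fin n → ℕ}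
  {p : Fin n → Polynomial ℂ} {A : ℂ} {β τ : ℝ}

/-- The filter of approach `z → 0` inside the region `‖z‖ ≤ |u|^β`, `u = z^α ≠ 0`. A property
holds along it iff it holds on this region over a punctured neighbourhood of `u = 0`. -/
noncomputable def basinFilter (α : Fin n → ℕ) (β : ℝ) : Filter (Fin n → ℂ) :=
  comap (mon α) (𝓝[≠] 0) ⊓ 𝓟 {z | ‖z‖ ≤ ‖mon α z‖ ^ β}

lemma tendsto_mon_basinFilter (α : Fin n → ℕ) (β : ℝ) :
    Tendsto (mon α) (basinFilter α β) (𝓝[≠] 0) :=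
  tendsto_comap.mono_left inf_le_left

lemma eventually_basinFilter_ne_zero (α : Fin n → ℕ) (β : ℝ) :
    ∀ᶠ z in basinFilter α β, mon α z ≠ 0 :=
  (tendsto_mon_basinFilter α β).eventually self_mem_nhdsWithin

lemma eventually_basinFilter_norm_le (α : Fin n → ℕ) (β : ℝ) :
    ∀ᶠ z in basinFilter α β, ‖z‖ ≤ ‖mon α z‖ ^ β :=
  mem_inf_of_right (mem_principal_self _)

lemma tendsto_norm_mon_rpow (α : Fin n → ℕ) (β : ℝ) {s : ℝ} (hs : 0 < s) :
    Tendsto (fun z => ‖mon α z‖ ^ s) (basinFilter α β) (𝓝 0) := by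
  simpa [Real.zero_rpow hs.ne'] using
    ((tendsto_mon_basinFilter α β).mono_right nhdsWithin_le_nhds).norm.rpow_const (Or.inr hs.le)

lemma basinFilter_le_nhds (α : Fin n → ℕ) (hβ : 0 < β) : basinFilter α β ≤ 𝓝 0 :=
  squeeze_zero_norm' (f := id) (eventually_basinFilter_norm_le α β) (tendsto_norm_mon_rpow α β hβ)

lemma isLittleO_basinFilter {E : Type*} [NormedAddCommGroup E] {f : (Fin n → ℂ) → E}
    (hf : f =O[𝓝 0] fun z => ‖z‖ ^ N) (α : Fin n → ℕ) (hβ : 0 < β) {s : ℝ} (hs : s < β * N) :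
    f =o[basinFilter α β] fun z => ‖mon α z‖ ^ s := by
  have hpow : (fun z : Fin n → ℂ => ‖z‖ ^ N) =O[basinFilter α β]
      fun z => ‖mon α z‖ ^ (β * N) := by
    refine IsBigO.of_bound' ?_
    filter_upwards [eventually_basinFilter_norm_le α β] with z hz
    rw [Real.rpow_mul (norm_nonneg _), Real.rpow_natCast, norm_pow, norm_pow, norm_norm]
    exact pow_le_pow_left₀ (norm_nonneg _) (hz.trans (le_abs_self _)) N
  have hlittle : (fun z => ‖mon α z‖ ^ (β * N)) =o[basinFilter α β] fun z => ‖mon α z‖ ^ s := by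
    refine ((isLittleO_one_iff ℝ).mpr (tendsto_norm_mon_rpow α β (sub_pos.mpr hs))).mul_isBigO
      (isBigO_refl (fun z => ‖mon α z‖ ^ s) _) |>.congr' ?_ (by simp)
    filter_upwards [eventually_basinFilter_ne_zero α β] with z hz
    rw [← Real.rpow_add (norm_pos_iff.mpr hz), sub_add_cancel]
  exact ((hf.mono (basinFilter_le_nhds α hβ)).trans hpow).trans_isLittleO hlittle

lemma norm_le_of_mem_basinOver {S : Set ℂ} {z : Fin n → ℂ} (hz : z ∈ basinOver α β S) :
    ‖z‖ ≤ ‖mon α z‖ ^ β :=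
  (pi_norm_le_iff_of_nonneg (by positivity)).mpr fun i => (hz.2 i).le

lemma eventually_forall_mem_basinOver (hA : A ≠ 0) (hk : 1 ≤ k) {P : (Fin n → ℂ) → Prop}
    (hP : ∀ᶠ z in basinFilter α β, P z) :
    ∀ᶠ δ in 𝓝[>] (0 : ℝ), ∀ ε v, ∀ z ∈ basinOver α β (petalSector A k δ ε v), P z := by
  obtain ⟨s, hs, hsP⟩ := mem_comap.mp (mem_inf_principal.mp hP)
  filter_upwards [eventually_petalSector_subset hA k (mem_nhdsWithin_iff_eventually.mp hs)]
    with δ hδ ε v z hz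
  exact hsP (hδ ε v hz.1 (ne_zero_of_mem_petalSector hk hz.1)) (norm_le_of_mem_basinOver hz)

lemma isLittleO_mon_comp_sub {h : ℂ → ℂ} (hβ : 0 < β) (hN : (k : ℝ) + 1 < β * N)
    (hh : (fun u : ℂ => h u - (u + A * u ^ (k + 1))) =o[𝓝 0] fun u => ‖u‖ ^ (k + 1))
    (hGh : (fun z => mon α (G z) - h (mon α z)) =O[𝓝 0] fun z => ‖z‖ ^ N) :
    (fun z => mon α (G z) - (mon α z + A * mon α z ^ (k + 1))) =o[basinFilter α β]
      fun z => ‖mon α z‖ ^ (k + 1) := by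
  have hGh' := isLittleO_basinFilter hGh α hβ hN
  simp only [← Nat.cast_add_one, Real.rpow_natCast] at hGh'
  exact (hGh'.add (hh.comp_tendsto ((tendsto_mon_basinFilter α β).mono_right
    nhdsWithin_le_nhds))).congr_left fun z => sub_add_sub_cancel _ _ _

lemma hasFDerivAt_norm_one_add_rpow (β : ℝ) :
    HasFDerivAt (fun x : ℂ => ‖1 + x‖ ^ β) (β • Complex.reCLM) 0 := by
  have hsq := ((hasFDerivAt_id (𝕜 := ℝ) (0 : ℂ)).const_add 1).norm_sq
  have h := hsq.rpow_const (p := β / 2) (by simp)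
  have hfun : (fun x : ℂ => ‖1 + x‖ ^ β) = fun x => (‖1 + id x‖ ^ 2) ^ (β / 2) := by
    ext x
    rw [id, ← Real.rpow_natCast, ← Real.rpow_mul (norm_nonneg _), Nat.cast_ofNat,
      mul_div_cancel₀ β two_ne_zero]
  rw [hfun]
  refine h.congr_fderiv (ContinuousLinearMap.ext fun x => ?_)
  simp
  ring

lemma eventually_le_norm_rpow {E : Type*} {l : Filter E} {u u' : E → ℂ} (hk : 1 ≤ k)
    (hu : Tendsto u l (𝓝[≠] 0))
    (hu' : (fun z => u' z - (u z + A * u z ^ (k + 1))) =o[l] fun z => ‖u z‖ ^ (k + 1))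
    (β : ℝ) {η : ℝ} (hη : 0 < η) :
    ∀ᶠ z in l, ‖u z‖ ^ β * (1 + β * (A * u z ^ k).re - η * ‖u z‖ ^ k) ≤ ‖u' z‖ ^ β := by
  obtain ⟨c, hc, hstep⟩ := exists_norm_sub_fderiv_le hk A (hasFDerivAt_norm_one_add_rpow β) hη
  have hclose := hu'.def hc
  simp only [norm_pow, norm_norm] at hclose
  filter_upwards [hclose, hu.eventually self_mem_nhdsWithin,
    hu.eventually (nhdsWithin_le_nhds hstep)] with z hz hz0 hstep
  have h := abs_le.mp (hstep _ (norm_div_sub_one_sub_le hz0 hz))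
  have hquot : ‖u' z‖ ^ β = ‖u z‖ ^ β * ‖1 + (u' z / u z - 1)‖ ^ β := by
    rw [← Real.mul_rpow (norm_nonneg _) (norm_nonneg _), ← norm_mul, add_sub_cancel,
      mul_div_cancel₀ _ hz0]
  rw [hquot]
  gcongr
  simp only [add_zero, norm_one, Real.one_rpow, smul_apply,
    Complex.reCLM_apply, smul_eq_mul] at h
  linarith [h.1]

lemma eventually_norm_resFactor_le (hk : 1 ≤ k) (a : Fin n → ℂ) (p : Fin n → Polynomial ℂ)
    {j : Fin n} (hj : ‖lam j‖ = 1) {η : ℝ} (hη : 0 < η) :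
    ∀ᶠ u in 𝓝 0, ‖resFactor lam a k p j u‖ ≤ 1 + (a j / lam j * u ^ k).re + η * ‖u‖ ^ k := by
  have hj0 : lam j ≠ 0 := norm_ne_zero_iff.mp (by rw [hj]; exact one_ne_zero)
  obtain ⟨c, hc, hstep⟩ := exists_norm_sub_fderiv_le hk (a j / lam j)
    (hasFDerivAt_norm_one_add_rpow 1) hη
  filter_upwards [hstep, ((isBigO_resFactor_expansion a k p hj0).trans_isLittleO
    (isLittleO_norm_pow_norm_pow k.lt_succ_self)).def hc] with u hstep hu
  have hx : ‖resFactor lam a k p j u / lam j - 1 - a j / lam j * u ^ k‖ ≤ c * ‖u‖ ^ k := by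
    have heq : resFactor lam a k p j u / lam j - 1 - a j / lam j * u ^ k =
        (resFactor lam a k p j u - lam j * (1 + a j / lam j * u ^ k)) / lam j := by
      field_simp
      ring
    rw [heq, norm_div, hj, div_one]
    simpa using hu
  have h := (abs_le.mp (hstep _ hx)).2
  simp only [add_sub_cancel, norm_div, hj, div_one, Real.rpow_one, add_zero, norm_one, one_smul,
    Complex.reCLM_apply] at h
  linarith

lemma exists_re_add_norm_le_re_mul {b : ℂ} (hτ : 0 ≤ τ) (hb : β + τ * |b.im| < b.re) :
    ∃ κ > 0, ∀ x ∈ cone 0 τ, β * x.re + κ * ‖x‖ ≤ (b * x).re := by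
  refine ⟨(b.re - β - τ * |b.im|) / (1 + τ), div_pos (by linarith) (by linarith),
    fun x hx => ?_⟩
  have him : b.im * x.im ≤ |b.im| * (τ * x.re) :=
    (le_abs_self _).trans (by rw [abs_mul]; gcongr; exact hx.2.le)
  have hnorm : (b.re - β - τ * |b.im|) / (1 + τ) * ‖x‖ ≤ (b.re - β - τ * |b.im|) * x.re := by
    rw [div_mul_eq_mul_div, div_le_iff₀ (by linarith), mul_assoc, mul_comm x.re]
    gcongr
    · linarith
    · exact norm_le_of_mem_cone le_rfl hx
  rw [Complex.mul_re]
  linarith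

/- Along the petal `|u|` decreases by the factor `1 + Re (A u^k)`, and `|z_j|` by the factor
`1 + Re (b A u^k)`, `b = a_j / (λ_j A)`; on a narrow sector with `β < Re b` the latter beats
the decay `1 + β Re (A u^k)` of `|u|^β`. -/
lemma eventually_norm_parabolic_coord_lt (hA : A ≠ 0) (hk : 1 ≤ k) (hτ : 0 ≤ τ) (hβ : 0 < β)
    (hN : (k : ℝ) + β < β * N)
    (hind : (fun z => mon α (G z) - (mon α z + A * mon α z ^ (k + 1))) =o[basinFilter α β]
      fun z => ‖mon α z‖ ^ (k + 1)) {j : Fin n}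
    (hnormal : (fun z => G z j - z j * resFactor lam a k p j (mon α z)) =O[𝓝 0]
      fun z => ‖z‖ ^ N)
    (hlam : ‖lam j‖ = 1)
    (hb : β + τ * |(a j * (lam j)⁻¹ * A⁻¹).im| < (a j * (lam j)⁻¹ * A⁻¹).re) :
    ∀ᶠ z in basinFilter α β, fatou A k (mon α z) ∈ cone 0 τ →
      ‖G z j‖ < ‖mon α (G z)‖ ^ β := by
  set b := a j * (lam j)⁻¹ * A⁻¹
  obtain ⟨κ, hκ, hcone⟩ := exists_re_add_norm_le_re_mul hτ hb
  have hη : 0 < κ * ‖A‖ / 4 := by positivity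
  have htend := tendsto_mon_basinFilter α β
  filter_upwards [eventually_le_norm_rpow hk htend hind β hη,
    htend.eventually (nhdsWithin_le_nhds (eventually_norm_resFactor_le hk a p hlam hη)),
    (isLittleO_basinFilter hnormal α hβ hN).def hη, eventually_basinFilter_norm_le α β,
    eventually_basinFilter_ne_zero α β] with z hlow hfactor herr hz hu hmem
  set u := mon α z
  have hupos : 0 < ‖u‖ := norm_pos_iff.mpr hu
  have hx : (fatou A k u)⁻¹ = -(A * u ^ k) := by rw [fatou, inv_neg, inv_inv]
  have hre : (b * (A * u ^ k)).re ≤ β * (A * u ^ k).re - κ * ‖A‖ * ‖u‖ ^ k := by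
    have h := hcone _ (inv_mem_cone_zero hmem)
    rw [hx, mul_neg, Complex.neg_re, Complex.neg_re, norm_neg, norm_mul, norm_pow] at h
    linarith
  rw [show a j / lam j * u ^ k = b * (A * u ^ k) by simp only [b]; field_simp] at hfactor
  rw [Real.rpow_add hupos, Real.rpow_natCast, Real.norm_of_nonneg (by positivity)] at herr
  refine lt_of_lt_of_le ?_ hlow
  calc ‖G z j‖ = ‖z j * resFactor lam a k p j u + (G z j - z j * resFactor lam a k p j u)‖ := by
        rw [add_sub_cancel]
    _ ≤ ‖u‖ ^ β * (1 + (β * (A * u ^ k).re - κ * ‖A‖ * ‖u‖ ^ k) + κ * ‖A‖ / 4 * ‖u‖ ^ k) +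
        κ * ‖A‖ / 4 * (‖u‖ ^ k * ‖u‖ ^ β) := by
      refine norm_add_le_of_le ?_ herr
      rw [norm_mul]
      gcongr
      · exact (norm_le_pi_norm z j).trans hz
      · linarith
    _ = ‖u‖ ^ β * (1 + β * (A * u ^ k).re - κ * ‖A‖ / 4 * ‖u‖ ^ k) -
        κ * ‖A‖ / 4 * (‖u‖ ^ k * ‖u‖ ^ β) := by ring
    _ < ‖u‖ ^ β * (1 + β * (A * u ^ k).re - κ * ‖A‖ / 4 * ‖u‖ ^ k) :=
      sub_lt_self _ (by positivity)

lemma eventually_norm_hyperbolic_coord_lt (hk : 1 ≤ k) (hβ : 0 < β)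
    (hind : (fun z => mon α (G z) - (mon α z + A * mon α z ^ (k + 1))) =o[basinFilter α β]
      fun z => ‖mon α z‖ ^ (k + 1)) {j : Fin n}
    (hlin : (fun z => G z j - lam j * z j) =O[𝓝 0] fun z => ‖z‖ ^ 2) (hlam : ‖lam j‖ < 1) :
    ∀ᶠ z in basinFilter α β, ‖G z j‖ < ‖mon α (G z)‖ ^ β := by
  set η : ℝ := (1 - ‖lam j‖) / 3
  have hη : 0 < η := div_pos (by linarith) (by norm_num)
  have htend := tendsto_mon_basinFilter α β
  have hlim : Tendsto (fun u : ℂ => 1 + β * (A * u ^ k).re - 1 * ‖u‖ ^ k) (𝓝 0) (𝓝 1) :=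
    Continuous.tendsto' (by fun_prop) _ _ (by simp [Nat.one_le_iff_ne_zero.mp hk])
  filter_upwards [eventually_le_norm_rpow hk htend hind β one_pos,
    htend.eventually (nhdsWithin_le_nhds (hlim.eventually_const_lt (sub_lt_self 1 hη))),
    (isLittleO_basinFilter hlin α hβ (show β < β * (2 : ℕ) by push_cast; linarith)).def hη,
    eventually_basinFilter_norm_le α β, eventually_basinFilter_ne_zero α β]
    with z hlow hfactor herr hz hu
  have hy : 0 < ‖mon α z‖ ^ β := Real.rpow_pos_of_pos (norm_pos_iff.mpr hu) β
  rw [Real.norm_of_nonneg hy.le] at herr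
  refine lt_of_lt_of_le ?_ hlow
  calc ‖G z j‖ = ‖lam j * z j + (G z j - lam j * z j)‖ := by rw [add_sub_cancel]
    _ ≤ ‖lam j‖ * ‖mon α z‖ ^ β + η * ‖mon α z‖ ^ β := by
      refine norm_add_le_of_le ?_ herr
      rw [norm_mul]
      gcongr
      exact (norm_le_pi_norm z j).trans hz
    _ = ‖mon α z‖ ^ β * (1 - 2 * η) := by simp only [η]; ring
    _ < ‖mon α z‖ ^ β * (1 + β * (A * mon α z ^ k).re - 1 * ‖mon α z‖ ^ k) :=
      mul_lt_mul_of_pos_left (by linarith) hy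

lemma eventually_basinOver_step (hA : A ≠ 0) (hk : 1 ≤ k) (hτ : 0 < τ)
    (hind : (fun z => mon α (G z) - (mon α z + A * mon α z ^ (k + 1))) =o[basinFilter α β]
      fun z => ‖mon α z‖ ^ (k + 1))
    (hcoord : ∀ j, ∀ᶠ z in basinFilter α β, fatou A k (mon α z) ∈ cone 0 τ →
      ‖G z j‖ < ‖mon α (G z)‖ ^ β) :
    ∀ᶠ z in basinFilter α β, ∀ v, IsAttractingDirection A k v → ∀ δ > 0,
      z ∈ basinOver α β (coneSector A k δ τ v) →
        G z ∈ basinOver α β (coneSector A k δ τ v) ∧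
        (fatou A k (mon α z)).re + 1 / 2 ≤ (fatou A k (mon α (G z))).re := by
  obtain ⟨c, hc, hstep⟩ := exists_coneSector_step hA hk hτ
  have hclose := hind.def hc
  simp only [norm_pow, norm_norm] at hclose
  filter_upwards [hclose, eventually_all.mpr hcoord,
    (tendsto_mon_basinFilter α β).eventually (nhdsWithin_le_nhds hstep)]
    with z hclose hcoord hstep v hv δ hδ hz
  have hcone := ((hv.mem_coneSector_iff hA hk hδ).mp hz.1).1
  obtain ⟨hmem, hre⟩ := hstep v hv δ hδ hz.1 _ hclose
  exact ⟨⟨hmem, fun j => hcoord j ⟨(by positivity : (0 : ℝ) < (2 * δ)⁻¹).trans hcone.1, hcone.2⟩⟩,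
    hre⟩

end BasinStep

section Basins

variable {n k : ℕ} {F G : (Fin n → ℂ) → (Fin n → ℂ)} {U : Set (Fin n → ℂ)} {α : Fin n → ℕ}
  {A v : ℂ} {S T : Set ℂ} {β δ τ : ℝ}

lemma isOpen_basinOver (hβ : 0 < β) (hS : IsOpen S) : IsOpen (basinOver α β S) := by
  rw [basinOver, Set.ofPred_and, Set.ofPred_forall]
  exact (hS.preimage (continuous_mon α)).inter <| isOpen_iInter_of_finite fun i =>
    isOpen_lt (by fun_prop) ((continuous_mon α).norm.rpow_const fun _ => Or.inr hβ.le)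

lemma basinOver_mem_nhdsWithin (hα : α ≠ 0) (h : S ∈ 𝓝[T] 0) :
    basinOver α β S ∈ 𝓝[basinOver α β T] 0 := by
  have hmon : Tendsto (mon α) (𝓝[basinOver α β T] 0) (𝓝[T] 0) := by
    rw [← mon_zero (n := n) hα]
    exact (continuous_mon α).continuousWithinAt.tendsto_nhdsWithin fun z hz => hz.1
  filter_upwards [self_mem_nhdsWithin, hmon h] with z hz hzS
  exact ⟨hzS, hz.2⟩

lemma disjoint_basinOver (h : Disjoint S T) :
    Disjoint (basinOver α β S) (basinOver α β T) :=
  (h.preimage (mon α)).mono (fun _ hz => hz.1) fun _ hz => hz.1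

lemma zero_notMem_basinOver (hα : α ≠ 0) (h : (0 : ℂ) ∉ S) : 0 ∉ basinOver α β S :=
  fun h0 => h (mon_zero hα ▸ h0.1)

lemma exists_mon_eq (hα : α ≠ 0) {u : ℂ} (hu : u ≠ 0) :
    ∃ z : Fin n → ℂ, mon α z = u ∧ ∀ i, ‖z i‖ = ‖u‖ ^ ((∑ i, α i : ℕ) : ℝ)⁻¹ := by
  obtain ⟨i₀, hi₀ : α i₀ ≠ 0⟩ := Function.ne_iff.mp hα
  have hu' : (‖u‖ : ℂ) ≠ 0 := by simpa using hu
  set t : ℝ := ‖u‖ ^ ((∑ i, α i : ℕ) : ℝ)⁻¹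
  have htpow : t ^ (∑ i, α i) = ‖u‖ :=
    Real.rpow_inv_natCast_pow (norm_nonneg u) (sum_pos_of_ne_zero hα).ne'
  set ζ : ℂ := (u / ‖u‖) ^ ((α i₀ : ℂ)⁻¹)
  have hζpow : ζ ^ α i₀ = u / ‖u‖ := Complex.cpow_nat_inv_pow _ hi₀
  have hζnorm : ‖ζ‖ = 1 := (pow_eq_one_iff_of_nonneg (norm_nonneg _) hi₀).mp <| by
    rw [← norm_pow, hζpow, norm_div, Complex.norm_real, norm_norm,
      div_self (norm_ne_zero_iff.mpr hu)]
  refine ⟨fun i => t * (Pi.mulSingle i₀ ζ : Fin n → ℂ) i, ?_, fun i => ?_⟩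
  · simp only [mon, mul_pow, Finset.prod_mul_distrib, Finset.prod_pow_eq_pow_sum]
    rw [Finset.prod_eq_single i₀ (fun i _ hi => by rw [Pi.mulSingle_eq_of_ne hi, one_pow])
      (by simp), Pi.mulSingle_eq_same, hζpow, ← Complex.ofReal_pow, htpow, mul_div_cancel₀ _ hu']
  · rw [norm_mul, Complex.norm_real, Real.norm_of_nonneg (by positivity)]
    obtain rfl | hi := eq_or_ne i i₀
    · rw [Pi.mulSingle_eq_same, hζnorm, mul_one]
    · rw [Pi.mulSingle_eq_of_ne hi, norm_one, mul_one]

lemma zero_mem_closure_basinOver (hα : α ≠ 0) (hβ : 0 < β) (hβα : β * (∑ i, α i : ℕ) < 1)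
    (hS0 : (0 : ℂ) ∉ S) (hS : (0 : ℂ) ∈ closure S) :
    (0 : Fin n → ℂ) ∈ closure (basinOver α β S) := by
  have hsum : (0 : ℝ) < (∑ i, α i : ℕ) := by exact_mod_cast sum_pos_of_ne_zero hα
  rw [Metric.mem_closure_iff]
  intro ρ hρ
  obtain ⟨u, hu, hur⟩ := Metric.mem_closure_iff.mp hS (min 1 (ρ ^ β⁻¹)) (by positivity)
  rw [dist_zero_left, lt_min_iff] at hur
  have hu0 : u ≠ 0 := fun h => hS0 (h ▸ hu)
  obtain ⟨z, rfl, hzn⟩ := exists_mon_eq hα hu0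
  have hz : z ∈ basinOver α β S := by
    refine ⟨hu, fun i => ?_⟩
    rw [hzn]
    refine Real.rpow_lt_rpow_of_exponent_gt (norm_pos_iff.mpr hu0) hur.1 ?_
    rwa [lt_inv_comm₀ hβ hsum, ← one_div, lt_div_iff₀ hβ, mul_comm]
  refine ⟨z, hz, ?_⟩
  rw [dist_zero_left]
  calc ‖z‖ ≤ ‖mon α z‖ ^ β := norm_le_of_mem_basinOver hz
    _ < (ρ ^ β⁻¹) ^ β := Real.rpow_lt_rpow (norm_nonneg _) hur.2 hβ
    _ = ρ := Real.rpow_inv_rpow hρ.le hβ.ne'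

lemma tendsto_iterate_of_fatou_step (hA : A ≠ 0) (hβ : 0 < β)
    (hmaps : Set.MapsTo G (basinOver α β S) (basinOver α β S))
    (hstep : ∀ z ∈ basinOver α β S,
      (fatou A k (mon α z)).re + 1 / 2 ≤ (fatou A k (mon α (G z))).re)
    {z : Fin n → ℂ} (hz : z ∈ basinOver α β S) : Tendsto (fun q => G^[q] z) atTop (𝓝 0) := by
  have hiter (q : ℕ) : G^[q] z ∈ basinOver α β S := hmaps.iterate q hz
  have hmon : Tendsto (fun q => mon α (G^[q] z)) atTop (𝓝 0) := by
    refine tendsto_zero_of_tendsto_fatou (k := k) hA (tendsto_atTop_of_add_half_le fun q => ?_)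
    rw [Function.iterate_succ_apply']
    exact hstep _ (hiter q)
  refine squeeze_zero_norm (fun q => norm_le_of_mem_basinOver (hiter q)) ?_
  simpa [Real.zero_rpow hβ.ne'] using hmon.norm.rpow_const (p := β) (Or.inr hβ.le)

lemma hasBasis_mapsTo_inter {X : Type*} [TopologicalSpace X] {f : X → X} {U : Set X} {x : X}
    (h : ∀ V ∈ 𝓝 x, ∃ U' ∈ 𝓝[U] x, U' ⊆ U ∩ V ∧ Set.MapsTo f U' U') :
    (𝓝 x).HasBasis (fun Ω => Ω ∈ 𝓝 x ∧ Set.MapsTo f (U ∩ Ω) (U ∩ Ω)) id := by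
  refine hasBasis_iff.mpr fun V =>
    ⟨fun hV => ?_, fun ⟨Ω, hΩ, hΩV⟩ => mem_of_superset hΩ.1 hΩV⟩
  obtain ⟨U', hU', hsub, hmaps⟩ := h V hV
  have hinter : U ∩ (U' ∪ V \ U) = U' := by
    rw [Set.inter_union_distrib_left, Set.inter_sdiff_self, Set.union_empty]
    exact Set.inter_eq_right.mpr (hsub.trans Set.inter_subset_left)
  refine ⟨U' ∪ V \ U, ⟨?_, by rwa [hinter]⟩,
    Set.union_subset (hsub.trans Set.inter_subset_right) Set.sdiff_subset⟩
  filter_upwards [hV, mem_nhdsWithin_iff_eventually.mp hU'] with y hyV hyU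
  exact (em (y ∈ U)).imp hyU fun hy => ⟨hyV, hy⟩

lemma zero_notMem_coneSector (hk : 1 ≤ k) : (0 : ℂ) ∉ coneSector A k δ τ v :=
  fun h => ne_zero_of_mem_petalSector hk h rfl

lemma isBasin_basinOver (hA : A ≠ 0) (hk : 1 ≤ k) (hv : IsAttractingDirection A k v)
    (hτ : 0 < τ) (hα : α ≠ 0) (hβ : 0 < β) (hβα : β * (∑ i, α i : ℕ) < 1) (hδ : 0 < δ)
    (hstep : ∀ z ∈ basinOver α β (coneSector A k δ τ v), ∀ δ' > 0,
      z ∈ basinOver α β (coneSector A k δ' τ v) →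
        G z ∈ basinOver α β (coneSector A k δ' τ v) ∧
        (fatou A k (mon α z)).re + 1 / 2 ≤ (fatou A k (mon α (G z))).re) :
    IsBasin G (basinOver α β (coneSector A k δ τ v)) := by
  have hclosure : 0 ∈ closure (basinOver α β (coneSector A k δ τ v)) :=
    zero_mem_closure_basinOver hα hβ hβα (zero_notMem_coneSector hk)
      (zero_mem_closure_coneSector hv hA hk hδ hτ)
  have hsmall : ∀ V ∈ 𝓝 0, ∃ U' ∈ 𝓝[basinOver α β (coneSector A k δ τ v)] 0,
      U' ⊆ basinOver α β (coneSector A k δ τ v) ∩ V ∧ Set.MapsTo G U' U' := by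
    intro V hV
    obtain ⟨δ', hδ', hsub⟩ := ((eventually_mem_nhdsWithin (a := (0 : ℝ)) (s := Set.Ioi 0)).and
      (eventually_forall_mem_basinOver hA hk (basinFilter_le_nhds α hβ hV))).exists
    refine ⟨basinOver α β (coneSector A k δ τ v) ∩ basinOver α β (coneSector A k δ' τ v),
      inter_mem self_mem_nhdsWithin
        (basinOver_mem_nhdsWithin hα (coneSector_mem_nhdsWithin hv hA hk hδ hδ')),
      Set.inter_subset_inter_right _ (hsub _ v), fun z hz => ?_⟩
    exact ⟨(hstep z hz.1 δ hδ hz.1).1, (hstep z hz.1 δ' hδ' hz.2).1⟩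
  exact ⟨isOpen_basinOver hβ (isOpen_coneSector hv hA hk), closure_nonempty_iff.mp ⟨0, hclosure⟩,
    hclosure, _, hasBasis_mapsTo_inter hsmall, fun Ω hΩ => ⟨hΩ.2, fun z hz =>
      tendsto_iterate_of_fatou_step hA hβ (fun z hz => (hstep z hz δ hδ hz).1)
        (fun z hz => (hstep z hz δ hδ hz).2) hz.1⟩⟩

lemma eventually_isBasin_basinOver (hA : A ≠ 0) (hk : 1 ≤ k) (hτ : 0 < τ) (hα : α ≠ 0)
    (hβ : 0 < β) (hβα : β * (∑ i, α i : ℕ) < 1)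
    (hind : (fun z => mon α (G z) - (mon α z + A * mon α z ^ (k + 1))) =o[basinFilter α β]
      fun z => ‖mon α z‖ ^ (k + 1))
    (hcoord : ∀ j, ∀ᶠ z in basinFilter α β, fatou A k (mon α z) ∈ cone 0 τ →
      ‖G z j‖ < ‖mon α (G z)‖ ^ β) :
    ∀ᶠ δ in 𝓝[>] (0 : ℝ), ∀ v, IsAttractingDirection A k v →
      IsBasin G (basinOver α β (coneSector A k δ τ v)) := by
  filter_upwards [self_mem_nhdsWithin, eventually_forall_mem_basinOver hA hk
    (eventually_basinOver_step hA hk hτ hind hcoord)] with δ hδ hstep v hv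
  exact isBasin_basinOver hA hk hv hτ hα hβ hβα hδ fun z hz => hstep _ v z hz v hv

lemma exists_isAttractingPetal_isBasin {h : ℂ → ℂ} {W : Set (Fin n → ℂ)} (hA : A ≠ 0)
    (hk : 1 ≤ k) (hτ : 0 < τ) (hα : α ≠ 0) (hβ : 0 < β) (hβα : β * (∑ i, α i : ℕ) < 1)
    (ha : AnalyticAt ℂ h 0)
    (hh : (fun u => h u - (u + A * u ^ (k + 1))) =o[𝓝 0] fun u => ‖u‖ ^ (k + 1))
    (hind : (fun z => mon α (G z) - (mon α z + A * mon α z ^ (k + 1))) =o[basinFilter α β]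
      fun z => ‖mon α z‖ ^ (k + 1))
    (hcoord : ∀ j, ∀ᶠ z in basinFilter α β, fatou A k (mon α z) ∈ cone 0 τ →
      ‖G z j‖ < ‖mon α (G z)‖ ^ β)
    (hW : W ∈ 𝓝 0) :
    ∃ δ > 0, ∀ v, IsAttractingDirection A k v →
      IsAttractingPetal h v (coneSector A k δ τ v) ∧
      IsBasin G (basinOver α β (coneSector A k δ τ v)) ∧
      basinOver α β (coneSector A k δ τ v) ⊆ W := by
  obtain ⟨δ, ⟨⟨hδ, hP⟩, hB⟩, hBW⟩ := (((eventually_mem_nhdsWithin.and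
    (eventually_isAttractingPetal hA hk hτ ha hh)).and
    (eventually_isBasin_basinOver hA hk hτ hα hβ hβα hind hcoord)).and
    (eventually_forall_mem_basinOver hA hk (basinFilter_le_nhds α hβ hW))).exists
  exact ⟨δ, hδ, fun v hv => ⟨hP v hv, hB v hv, hBW _ v⟩⟩

lemma IsBasin.image (hU : IsBasin G U) {e : OpenPartialHomeomorph (Fin n → ℂ) (Fin n → ℂ)}
    (he : 0 ∈ e.source) (he0 : e 0 = 0) (hUe : U ⊆ e.source)
    (hconj : ∀ z ∈ U, F (e z) = e (G z)) : IsBasin F (e '' U) := by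
  have hcont := e.continuousAt he
  obtain ⟨𝒪, h𝒪, hinv⟩ := hU.exists_basis
  refine ⟨e.isOpen_image_of_subset_source hU.isOpen hUe, hU.nonempty.image e, ?_, _,
    he0 ▸ e.map_nhds_eq he ▸
      ((h𝒪.restrict_subset (e.open_source.mem_nhds he)).map e).to_image_id, ?_⟩
  · simpa only [he0] using hcont.continuousWithinAt.mem_closure_image hU.zero_mem_closure
  rintro _ ⟨Ω, ⟨hΩ, hΩe⟩, rfl⟩
  obtain ⟨hmaps, htend⟩ := hinv Ω hΩ
  simp only [id] at hΩe ⊢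
  rw [← e.injOn.image_inter hUe hΩe]
  refine ⟨?_, ?_⟩
  · rintro _ ⟨z, hz, rfl⟩
    exact ⟨G z, hmaps hz, (hconj z hz.1).symm⟩
  · rintro _ ⟨z, hz, rfl⟩
    have hiter (q : ℕ) : e (G^[q] z) = F^[q] (e z) := by
      induction q with
      | zero => rfl
      | succ q ih =>
        rw [Function.iterate_succ_apply', Function.iterate_succ_apply', ← ih,
          hconj _ (hmaps.iterate q hz).1]
    simpa only [Function.comp_def, he0, hiter] using hcont.tendsto.comp (htend z hz)

lemma IsBasin.zero_mem_frontier (hU : IsBasin F U) (h0 : 0 ∉ U) : 0 ∈ frontier U := by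
  rw [hU.isOpen.frontier_eq]
  exact ⟨hU.zero_mem_closure, h0⟩

lemma disjoint_image_of_injOn {X Y : Type*} {f : X → Y} {s t w : Set X} (hf : Set.InjOn f w)
    (hs : s ⊆ w) (ht : t ⊆ w) (h : Disjoint s t) : Disjoint (f '' s) (f '' t) := by
  rw [Set.disjoint_iff_inter_eq_empty, ← hf.image_inter hs ht, h.inter_eq, Set.image_empty]

end Basins

section OneResonant

variable {n m k N : ℕ} {F G : (Fin n → ℂ) → (Fin n → ℂ)} {lam a : Fin n → ℂ} {α : Fin n → ℕ}
  {p : Fin n → Polynomial ℂ} {A : ℂ} {β τ : ℝ}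

lemma IsOneResonant.mon_index_eq_one (hres : IsOneResonant F lam m α)
    (hlam : ∀ j : Fin n, (j : ℕ) < m → lam j ≠ 0) : mon α lam = 1 := by
  obtain ⟨j, hj⟩ : ∃ j : Fin n, (j : ℕ) < m := ⟨⟨0, hres.one_le.trans hres.le_dim⟩, hres.one_le⟩
  have h := ((hres.resonance_iff j hj _).mpr ⟨1, le_rfl, rfl⟩).2
  rw [mon_smul_add_single, pow_one] at h
  exact (right_eq_mul₀ (hlam j hj)).mp h

lemma exists_exponent {ι : Type*} [Finite ι] {b : ι → ℂ} {P : ι → Prop}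
    (hb : ∀ j, P j → 0 < (b j).re) (M c : ℝ) :
    ∃ (β : ℝ) (N : ℕ), 0 < β ∧ β < 1 ∧ β * M < 1 ∧ c < β * N ∧
      ∀ j, P j → β + β * |(b j).im| < (b j).re := by
  have hsmall {c d : ℝ} (hd : 0 < d) : ∀ᶠ x in 𝓝[>] (0 : ℝ), x * c < d :=
    nhdsWithin_le_nhds ((Continuous.tendsto' (by fun_prop) 0 0 (zero_mul c)).eventually_lt_const hd)
  have hall : ∀ᶠ x in 𝓝[>] (0 : ℝ), ∀ j, P j → x * (1 + |(b j).im|) < (b j).re :=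
    eventually_all.mpr fun j => eventually_imp_distrib_left.mpr fun hj => hsmall (hb j hj)
  obtain ⟨β, hβ : 0 < β, hβ1, hβM, hβb⟩ := (eventually_mem_nhdsWithin.and
    ((hsmall (c := 1) one_pos).and ((hsmall (c := M) one_pos).and hall))).exists
  obtain ⟨N, hN⟩ := exists_nat_gt (c / β)
  exact ⟨β, N, hβ, by simpa using hβ1, hβM, (div_lt_iff₀' hβ).mp hN,
    fun j hj => by linarith [hβb j hj]⟩

lemma IsParabolicallyAttracting.ne_zero (hpar : IsParabolicallyAttracting lam m α a) (j : Fin n)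
    (hj : (j : ℕ) < m) : lam j ≠ 0 :=
  norm_ne_zero_iff.mp ((hpar j hj).1 ▸ one_ne_zero)

lemma IsLeadingForm.eventually_norm_coord_lt (hG : IsLeadingForm G lam m α k a)
    (hGd : IsNormalUpTo G lam m α k a p N) (hlam : ∀ j : Fin n, (j : ℕ) < m → ‖lam j‖ = 1)
    (hattr : ∀ j : Fin n, m ≤ (j : ℕ) → ‖lam j‖ < 1) (hA : A ≠ 0) (hτ : 0 ≤ τ) (hβ : 0 < β)
    (hN : (k : ℝ) + β < β * N)
    (hind : (fun z => mon α (G z) - (mon α z + A * mon α z ^ (k + 1))) =o[basinFilter α β]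
      fun z => ‖mon α z‖ ^ (k + 1))
    (hb : ∀ j : Fin n, (j : ℕ) < m →
      β + τ * |(a j * (lam j)⁻¹ * A⁻¹).im| < (a j * (lam j)⁻¹ * A⁻¹).re) (j : Fin n) :
    ∀ᶠ z in basinFilter α β, fatou A k (mon α z) ∈ cone 0 τ →
      ‖G z j‖ < ‖mon α (G z)‖ ^ β := by
  obtain hj | hj := lt_or_ge (j : ℕ) m
  · exact eventually_norm_parabolic_coord_lt hA hG.one_le hτ hβ hN hind (hGd j hj) (hlam j hj)
      (hb j hj)
  · have hlin := isBigO_pi.mp (isBigO_sub_fderiv hG.diffeo.analytic hG.diffeo.map_zero) j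
    simp only [Pi.sub_apply, hG.diagonal] at hlin
    exact (eventually_norm_hyperbolic_coord_lt hG.one_le hβ hind hlin (hattr j hj)).mono
      fun z hz _ => hz

lemma IsLeadingForm.exists_isAttractingPetal_isBasin (hG : IsLeadingForm G lam m α k a)
    (hGN : IsNormalUpTo G lam m α k a p N) (hlam : ∀ j : Fin n, (j : ℕ) < m → ‖lam j‖ = 1)
    (hattr : ∀ j : Fin n, m ≤ (j : ℕ) → ‖lam j‖ < 1) (hA : A ≠ 0) (hα : α ≠ 0) (hβ : 0 < β)
    (hβ1 : β < 1) (hβα : β * (∑ i, α i : ℕ) < 1) (hN : (k : ℝ) + 1 < β * N)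
    {h : ℂ → ℂ} (ha : AnalyticAt ℂ h 0)
    (hh : (fun u => h u - (u + A * u ^ (k + 1))) =O[𝓝 0] fun u => ‖u‖ ^ (k + 2))
    (hGh : (fun z => mon α (G z) - h (mon α z)) =O[𝓝 0] fun z => ‖z‖ ^ N)
    (hb : ∀ j : Fin n, (j : ℕ) < m →
      β + β * |(a j * (lam j)⁻¹ * A⁻¹).im| < (a j * (lam j)⁻¹ * A⁻¹).re)
    {W : Set (Fin n → ℂ)} (hW : W ∈ 𝓝 0) :
    ∃ δ > 0, ∀ v, IsAttractingDirection A k v →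
      IsAttractingPetal h v (coneSector A k δ β v) ∧
      IsBasin G (basinOver α β (coneSector A k δ β v)) ∧
      basinOver α β (coneSector A k δ β v) ⊆ W := by
  have hh' := hh.trans_isLittleO (isLittleO_norm_pow_norm_pow (k + 1).lt_succ_self)
  have hind := isLittleO_mon_comp_sub hβ hN hh' hGh
  exact OneRes.exists_isAttractingPetal_isBasin hA hG.one_le hβ hα hβ hβα ha hh' hind
    (hG.eventually_norm_coord_lt hGN hlam hattr hA hβ.le hβ (by linarith) hind hb) hW

end OneResonant

end OneRes

theorem theorem1p1 {n : ℕ} (F : (Fin n → ℂ) → (Fin n → ℂ)) (lam : Fin n → ℂ)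
    (m : ℕ) (α : Fin n → ℕ) (k : ℕ) (a : Fin n → ℂ)
    (hF : OneRes.IsGermDiffeo F)
    (hres : OneRes.IsOneResonant F lam m α)
    (hord : OneRes.HasOrder F lam m α k a)
    (hnondeg : OneRes.bigLam lam m α a ≠ 0)
    (hpar : OneRes.IsParabolicallyAttracting lam m α a)
    (hattr : ∀ j : Fin n, m ≤ (j : ℕ) → ‖lam j‖ < 1) :
    ∃ B : Fin k → Set (Fin n → ℂ),
      Pairwise (fun i j => Disjoint (B i) (B j)) ∧
      (∀ j, OneRes.IsBasin F (B j) ∧ (0 : Fin n → ℂ) ∈ frontier (B j)) ∧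
      OneRes.BuiltOverPetals F lam m α k a B := by
  obtain ⟨β, N, hβ, hβ1, hβα, hN, hb⟩ := OneRes.exists_exponent (fun j hj => (hpar j hj).2)
    (∑ i, α i : ℕ) ((k : ℝ) + 1)
  have hα := hres.index_ne_zero
  obtain ⟨φ, G, p, hφ, hG, hGN⟩ := hord.exists_conjugates_isNormalUpTo hα
    (fun j hj l hl => ((hres.resonance_iff j hj l).mp hl).imp fun _ => And.right) N
  have hk := hG.one_le
  have ha := OneRes.analyticAt_inducedGerm lam a α k p 0
  have hh := OneRes.isBigO_inducedGerm_sub hk a p hres.index_supp hpar.ne_zero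
    (hres.mon_index_eq_one hpar.ne_zero)
  have hGh := hGN.isBigO_mon_comp_sub_inducedGerm hG.diffeo hres.index_supp
  obtain ⟨e, rfl, he, hφe, hconj⟩ := hφ.exists_chart
  obtain ⟨δ, hδ, hpetal⟩ := hG.exists_isAttractingPetal_isBasin hGN (fun j hj => (hpar j hj).1)
    hattr hnondeg hα hβ hβ1 hβα hN ha hh hGh hb (e.open_source.mem_nhds he)
  obtain ⟨v, hvinj, hv⟩ := OneRes.exists_injective_isAttractingDirection hnondeg hk
  choose hP hB hBe using fun j => hpetal (v j) (hv j)
  have himage (j : Fin k) := (hB j).image he hφ.diffeo.map_zero (hBe j) fun z hz =>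
    hconj z (hBe j hz)
  have h0 (j : Fin k) : 0 ∉ e '' OneRes.basinOver α β _ := hφ.diffeo.map_zero ▸
    (e.injOn.mem_image_iff (hBe j) he).not.mpr
      (OneRes.zero_notMem_basinOver hα (OneRes.zero_notMem_coneSector hk))
  exact ⟨_, fun i j hij => OneRes.disjoint_image_of_injOn e.injOn (hBe i) (hBe j)
    (OneRes.disjoint_basinOver
      (OneRes.disjoint_coneSector (hv i) (hv j) (hvinj.ne hij) hnondeg hk)),
    fun j => ⟨himage j, (himage j).zero_mem_frontier (h0 j)⟩, e, G, e.source, _, N, β, δ, _, v, _,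
    hφ, hG, e.open_source, he, hφe, e.injOn, ha, hh, hGh, hβ, hβα, hN, hδ,
    div_pos (Real.arctan_pos.mpr hβ) (by exact_mod_cast hk), hvinj, hv, hP, fun j => subset_rfl,
    hBe, fun j => rfl⟩
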